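/- All graphs are finite and simple. For an edge $e=uv$ of a graph $G$ let $N^2_G[e]$ be the set of all edges of $G$ incident to a vertex of $N_G(u)\cup N_G(v)$, i.e. $e$ itself, the edges adjacent to $e$, and the edges adjacent to an edge adjacent to $e$. A strong $k$-edge-coloring of $G$ is a map $f:E(G)\to\{1,\dots,k\}$ with $f(e)\neq f(e')$ for all distinct $e,e'\in E(G)$ with $e'\in N^2_G[e]$, and the strong chromatic index $\chi'_s(G)$ is the smallest $k$ for which $G$ admits a strong $k$-edge-coloring. Let $\Delta(G)$ be the maximum degree of $G$, and let $\mathrm{Mad}(G)=\max_{H} \frac{2|E(H)|}{|V(H)|}$, the maximum being over all subgraphs $H$ of $G$ with at least one vertex. **Theorem.** Let $\Delta\ge 7$ be an integer and let $G$ be a graph with no $3$-regular subgraph (that is, no nonempty subgraph, induced or not, is $3$-regular). If $\Delta(G)\le\Delta$ and $\mathrm{Mad}(G)\le 3$, then $\chi'_s(G)\le 3\Delta$. -/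

import Mathlib

namespace SimpleGraph

variable {V : Type*}

/-- The second edge neighbourhood `N²_G[e]` of an edge `e = uv`: all edges of `G` incident to a
vertex of `N_G(u) ∪ N_G(v)`.  Since `u ∈ N_G(v)` and `v ∈ N_G(u)`, it contains `e`, the edges
adjacent to `e`, and the edges adjacent to an edge adjacent to `e`. -/
def edgeSqNeighborhood (G : SimpleGraph V) (e : Sym2 V) : Set (Sym2 V) :=
  {e' | e' ∈ G.edgeSet ∧ ∃ x ∈ e, ∃ w ∈ e', G.Adj x w}

/-- `f` is a strong edge-coloring of `G` with color set `K`: any two distinct edges, one in the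
second edge neighbourhood of the other, receive distinct colors. -/
def IsStrongEdgeColoring (G : SimpleGraph V) {K : Type*} (f : G.EdgeLabeling K) : Prop :=
  ∀ e e' : G.edgeSet, e' ≠ e → (e' : Sym2 V) ∈ G.edgeSqNeighborhood e → f e ≠ f e'

/-- `G` admits a strong `k`-edge-coloring. -/
def StrongEdgeColorable (G : SimpleGraph V) (k : ℕ) : Prop :=
  ∃ f : G.EdgeLabeling (Fin k), G.IsStrongEdgeColoring f

/-- The strong chromatic index `χ'_s(G)`: the smallest `k` such that `G` admits a strong
`k`-edge-coloring (`⊤` if there is none). -/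
noncomputable def strongChromaticIndex (G : SimpleGraph V) : ℕ∞ :=
  ⨅ k ∈ {k : ℕ | G.StrongEdgeColorable k}, (k : ℕ∞)

/-- The average degree `2|E(H)| / |V(H)|` of a (finite, nonempty) subgraph `H`. -/
noncomputable def Subgraph.averageDegree {G : SimpleGraph V} (H : G.Subgraph) : ℝ :=
  2 * (H.edgeSet.ncard : ℝ) / (H.verts.ncard : ℝ)

/-- The maximum average degree of a finite graph: the maximum of the average degrees of its
nonempty subgraphs (`0` for the graph without vertices). -/
noncomputable def maxAverageDegree (G : SimpleGraph V) : ℝ :=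
  ⨆ H : {H : G.Subgraph // H.verts.Nonempty}, H.1.averageDegree

/-- `G` has a (nonempty, not necessarily induced) `d`-regular subgraph. -/
def HasRegularSubgraph (G : SimpleGraph V) (d : ℕ) : Prop :=
  ∃ H : G.Subgraph, H.verts.Nonempty ∧ ∀ v ∈ H.verts, (H.neighborSet v).encard = d

end SimpleGraph

/-! Take a counterexample `G` with fewest edges. Inside its edge set choose an uncolorable set,
viewed as a subgraph `K`, from which the greedy argument can remove nothing: each edge of `K` is
near at least `3D` others. Counting these through neighborhoods gives the inequality `Core.edge`,
which forces large `K`-degrees around low-degree vertices of `G`. Also `K` meets every non-isolated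
vertex, since otherwise a coloring of `G` without that vertex would color `K`. Replacing two links
by one edge excludes the configuration in `Core.link`.

The rest is discharging. Discard vertices of degree at most one and give each remaining vertex four
times (remaining degree minus 3); sparseness makes the total nonpositive. A 2-vertex needs 4: it
always has a rich neighbor (`Core.rich_or_rich`), which pays whatever the other neighbor does not
offer. Rich vertices also refund 3-vertices for what these give to 2-vertices. No vertex ends
negative, so all end at zero (`Core.balance_eq_zero`).

Equality is very restrictive. Once `Small` vertices are excluded, each vertex of degree at least
four has exactly three neighbors of degree at least four, so such vertices would induce a 3-regular
subgraph. Hence there are none, so no rich vertices, no 2-vertices and no leaves, and `G` itself is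
3-regular up to isolated vertices. -/

namespace SimpleGraph
namespace StrongEdge

open Finset
open scoped Classical

/-! ### Coloring sets of edges: greedy extension and cores -/

/-- Some edge of `G` joins an endpoint of `e` to an endpoint of `e'`. -/
def Near {V : Type*} (G : SimpleGraph V) (e e' : Sym2 V) : Prop :=
  ∃ x ∈ e, ∃ w ∈ e', G.Adj x w

/-- `f` gives distinct colors to distinct members of `X` that are near each other in `G`. -/
def ProperOn {V : Type*} (G : SimpleGraph V) (X : Set (Sym2 V)) {N : ℕ} (f : Sym2 V → Fin N) :
    Prop :=
  ∀ e ∈ X, ∀ e' ∈ X, e ≠ e' → Near G e e' → f e ≠ f e'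

/-- `X` can be colored with `N` colors so that near members receive distinct colors. -/
def ColorableOn {V : Type*} (G : SimpleGraph V) (X : Set (Sym2 V)) (N : ℕ) : Prop :=
  ∃ f : Sym2 V → Fin N, ProperOn G X f

theorem Near.symm {V : Type*} {G : SimpleGraph V} {e e' : Sym2 V} (h : Near G e e') :
    Near G e' e := by
  obtain ⟨x, hx, w, hw, h⟩ := h
  exact ⟨w, hw, x, hx, h.symm⟩

theorem ColorableOn.mono {V : Type*} {G : SimpleGraph V} {X Y : Set (Sym2 V)} {N : ℕ}
    (h : ColorableOn G Y N) (hXY : X ⊆ Y) : ColorableOn G X N := by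
  obtain ⟨f, hf⟩ := h
  exact ⟨f, fun e he e' he' => hf e (hXY he) e' (hXY he')⟩

theorem strongEdgeColorable_of_colorableOn {V : Type*} {G : SimpleGraph V} {N : ℕ}
    (h : ColorableOn G G.edgeSet N) : G.StrongEdgeColorable N := by
  obtain ⟨f, hf⟩ := h
  refine ⟨fun e => f e, fun e e' hne hmem => ?_⟩
  exact hf e e.2 e' e'.2 (fun h => hne (Subtype.ext h.symm)) hmem.2

/-- Greedy extension of a coloring by one more edge. -/
theorem ColorableOn.insert {V : Type*} {G : SimpleGraph V} {X : Finset (Sym2 V)} {N : ℕ}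
    {e : Sym2 V} (h : ColorableOn G (X : Set (Sym2 V)) N)
    (hc : #{e' ∈ X | Near G e e'} < N) :
    ColorableOn G (insert e X : Finset (Sym2 V)) N := by
  obtain ⟨f, hf⟩ := h
  have hex : ∃ c : Fin N, c ∉ ({e' ∈ X | Near G e e'} : Finset _).image f := by
    by_contra! hall
    have h1 : (univ : Finset (Fin N)) ⊆ ({e' ∈ X | Near G e e'} : Finset _).image f :=
      fun c _ => hall c
    have h2 := card_le_card h1
    have h3 := card_image_le (s := ({e' ∈ X | Near G e e'} : Finset _)) (f := f)
    simp only [card_univ, Fintype.card_fin] at h2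
    omega
  obtain ⟨c, hc⟩ := hex
  have hc' : ∀ e' ∈ X, Near G e e' → f e' ≠ c := by
    intro e' he' hn hfc
    exact hc (mem_image.2 ⟨e', mem_filter.2 ⟨he', hn⟩, hfc⟩)
  refine ⟨Function.update f e c, ?_⟩
  intro a ha a' ha' hne hn
  simp only [coe_insert, Set.mem_insert_iff, mem_coe] at ha ha'
  by_cases h1 : a = e
  · have h2 : a' ≠ e := fun h => hne (h1.trans h.symm)
    rw [h1, Function.update_self, Function.update_of_ne h2]
    exact (hc' a' (ha'.resolve_left h2) (h1 ▸ hn)).symm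
  · rw [Function.update_of_ne h1]
    by_cases h2 : a' = e
    · rw [h2, Function.update_self]
      exact hc' a (ha.resolve_left h1) (h2 ▸ hn).symm
    · rw [Function.update_of_ne h2]
      exact hf a (ha.resolve_left h1) a' (ha'.resolve_left h2) hne hn

/-- A non-colorable set of edges contains a non-colorable core, all of whose members are near to
at least `N` others. -/
theorem exists_core {V : Type*} {G : SimpleGraph V} {X : Finset (Sym2 V)} {N : ℕ}
    (h : ¬ ColorableOn G (X : Set (Sym2 V)) N) :
    ∃ K ⊆ X, ¬ ColorableOn G (K : Set (Sym2 V)) N ∧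
      ∀ e ∈ K, N ≤ #{e' ∈ K.erase e | Near G e e'} := by
  induction X using Finset.strongInduction with
  | H X ih =>
    by_cases hX : ∀ e ∈ X, N ≤ #{e' ∈ X.erase e | Near G e e'}
    · exact ⟨X, Subset.rfl, h, hX⟩
    · push Not at hX
      obtain ⟨e, he, hlt⟩ := hX
      have hn : ¬ ColorableOn G (X.erase e : Set (Sym2 V)) N := by
        intro hc
        have := hc.insert hlt
        rw [insert_erase he] at this
        exact h this
      obtain ⟨K, hK, h1, h2⟩ := ih _ (erase_ssubset he) hn
      exact ⟨K, hK.trans (erase_subset _ _), h1, h2⟩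

/-! ### Hereditary hypotheses and the count of near edges -/

/-- The hereditary hypotheses: maximum degree at most `D`, every vertex set `S` spans at most
`3|S|/2` edges, and there is no nonempty `3`-regular subgraph. -/
structure Good {V : Type*} [Fintype V] (D : ℕ) (G : SimpleGraph V) : Prop where
  degree_le : ∀ v, G.degree v ≤ D
  sparse : ∀ S : Finset V, 2 * #{e ∈ G.edgeFinset | ∀ x ∈ e, x ∈ S} ≤ 3 * #S
  noReg : ∀ H : SimpleGraph V, H ≤ G → (∀ v, H.degree v = 0 ∨ H.degree v = 3) → H = ⊥

theorem Good.mono {V : Type*} [Fintype V] {D : ℕ} {G G' : SimpleGraph V} (h : Good D G)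
    (hle : G' ≤ G) : Good D G' where
  degree_le v := (degree_le_of_le hle).trans (h.degree_le v)
  sparse S := by
    refine le_trans ?_ (h.sparse S)
    gcongr
  noReg H hH := h.noReg H (hH.trans hle)

/-- A coloring of the subgraph `G'` is proper in `G` on every set of edges of `G'` whose members
are near in `G'` whenever they are near in `G`. -/
theorem ColorableOn.of_graph {V : Type*} {G G' : SimpleGraph V} {X : Set (Sym2 V)} {N : ℕ}
    (h : ColorableOn G' G'.edgeSet N) (hX : X ⊆ G'.edgeSet)
    (hn : ∀ e ∈ X, ∀ e' ∈ X, e ≠ e' → Near G e e' → Near G' e e') : ColorableOn G X N := by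
  obtain ⟨f, hf⟩ := h
  exact ⟨f, fun e he e' he' hne h => hf e (hX he) e' (hX he') hne (hn e he e' he' hne h)⟩

/-- The sum of the `K`-degrees of the `G`-neighbors of `u`. -/
noncomputable def nbrSum {V : Type*} [Fintype V] (G K : SimpleGraph V) (u : V) : ℕ :=
  ∑ x ∈ G.neighborFinset u, K.degree x

/-- The number of members of `K` near an edge `uw` of `K` is bounded by neighborhood sums. -/
theorem card_near_le {V : Type*} [Fintype V] {G K : SimpleGraph V} (hK : K ≤ G) {u w : V}
    (h : K.Adj u w) :
    #{e ∈ K.edgeFinset.erase s(u, w) | Near G s(u, w) e} + K.degree u + K.degree w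
      ≤ nbrSum G K u + nbrSum G K w := by
  have hsub : ({e ∈ K.edgeFinset.erase s(u, w) | Near G s(u, w) e} : Finset _) ⊆
      ((G.neighborFinset u).erase w).biUnion (fun y => K.incidenceFinset y) ∪
      ((G.neighborFinset w).erase u).biUnion (fun y => K.incidenceFinset y) := by
    -- If `y` is the other end `b` of the edge, then `e` is charged to its second endpoint, a
    -- neighbor of `b` other than `a`. This is why the term of the opposite endpoint can be dropped
    -- from each neighborhood sum.
    have key : ∀ a b : V, ∀ e ∈ K.edgeFinset, e ≠ s(a, b) → ∀ y ∈ e, G.Adj a y →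
        (y ≠ b → ∃ z, z ≠ b ∧ G.Adj a z ∧ e ∈ K.incidenceSet z) ∧
        (y = b → ∃ z, z ≠ a ∧ G.Adj b z ∧ e ∈ K.incidenceSet z) := by
      intro a b e he hne y hy hay
      rw [mem_edgeFinset] at he
      refine ⟨fun hyb => ⟨y, hyb, hay, he, hy⟩, ?_⟩
      rintro rfl
      obtain ⟨z, rfl⟩ := Sym2.mem_iff_exists.1 hy
      refine ⟨z, ?_, hK he, he, Sym2.mem_mk_right _ _⟩
      rintro rfl
      exact hne Sym2.eq_swap
    intro e he
    obtain ⟨he', x, hx, y, hy, hxy⟩ := mem_filter.1 he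
    have hne := (mem_erase.1 he').1
    have heK := (mem_erase.1 he').2
    simp only [mem_union, mem_biUnion, mem_erase, mem_neighborFinset, mem_incidenceFinset]
    rcases Sym2.mem_iff.1 hx with rfl | rfl
    · obtain ⟨h1, h2⟩ := key x w e heK hne y hy hxy
      by_cases hyw : y = w
      · obtain ⟨z, hz⟩ := h2 hyw
        exact Or.inr ⟨z, ⟨hz.1, hz.2.1⟩, hz.2.2⟩
      · obtain ⟨z, hz⟩ := h1 hyw
        exact Or.inl ⟨z, ⟨hz.1, hz.2.1⟩, hz.2.2⟩
    · obtain ⟨h1, h2⟩ := key x u e heK (fun h => hne (h.trans Sym2.eq_swap)) y hy hxy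
      by_cases hyu : y = u
      · obtain ⟨z, hz⟩ := h2 hyu
        exact Or.inl ⟨z, ⟨hz.1, hz.2.1⟩, hz.2.2⟩
      · obtain ⟨z, hz⟩ := h1 hyu
        exact Or.inr ⟨z, ⟨hz.1, hz.2.1⟩, hz.2.2⟩
  have h1 := (card_le_card hsub).trans (card_union_le _ _)
  have h2 : ∀ a b : V, K.Adj a b →
      #(((G.neighborFinset a).erase b).biUnion (fun y => K.incidenceFinset y)) + K.degree b
        ≤ nbrSum G K a := by
    intro a b hab
    have h3 : ∑ x ∈ (G.neighborFinset a).erase b, K.degree x + K.degree b = nbrSum G K a :=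
      sum_erase_add _ _ ((mem_neighborFinset _ _ _).2 (hK hab))
    rw [← h3]
    gcongr
    refine card_biUnion_le.trans (le_of_eq (sum_congr rfl fun x _ => ?_))
    exact K.card_incidenceFinset_eq_degree x
  have h4 := h2 u w h
  have h5 := h2 w u h.symm
  omega

/-! ### Minimal counterexamples: deleting a vertex or a triangle edge -/

/-- The data extracted from a minimal counterexample `G`: a subgraph `K` each of whose edges has
many edges of `K` near it, and which covers all non-isolated vertices. -/
structure Core {V : Type*} [Fintype V] (D : ℕ) (G K : SimpleGraph V) : Prop where
  good : Good D G
  le : K ≤ G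
  ne_bot : K ≠ ⊥
  pos : ∀ v, 0 < G.degree v → 0 < K.degree v
  edge : ∀ u w, K.Adj u w →
    3 * D + K.degree u + K.degree w ≤ nbrSum G K u + nbrSum G K w
  link : ∀ w v₁ v₂ u₁ u₂, G.degree v₁ = 2 → G.degree v₂ = 2 → G.degree u₁ = 2 →
    G.degree u₂ = 2 → G.Adj w v₁ → G.Adj w v₂ → G.Adj v₁ u₁ → G.Adj v₂ u₂ → v₁ ≠ v₂ →
    u₁ ≠ w → u₂ ≠ w → False

/-- Graphs with the same maximal degree, sparseness, and no 3-regular subgraph, but fewer edges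
than `G`, are colorable. -/
def SmallerColorable {V : Type*} [Fintype V] (D : ℕ) (G : SimpleGraph V) : Prop :=
  ∀ G' : SimpleGraph V, Good D G' → G'.edgeSet.ncard < G.edgeSet.ncard →
    ColorableOn G' G'.edgeSet (3 * D)

/-- An edge witnessing nearness of two edges has an endpoint in each of them; if both avoid `v`, so
does the witness. Thus deleting all edges at `v` preserves nearness on the remaining edges. -/
theorem colorableOn_of_not_mem {V : Type*} [Fintype V] {D : ℕ} {G : SimpleGraph V}
    (hG : Good D G) (hmin : SmallerColorable D G) {v : V} (hv : 0 < G.degree v) :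
    ColorableOn G {e ∈ G.edgeSet | v ∉ e} (3 * D) := by
  have hset : (G.deleteEdges (G.incidenceSet v)).edgeSet = {e ∈ G.edgeSet | v ∉ e} := by
    ext e
    simp only [edgeSet_deleteEdges, Set.mem_sdiff, incidenceSet, Set.mem_ofPred_eq]
    tauto
  have hle : G.deleteEdges (G.incidenceSet v) ≤ G := deleteEdges_le _
  refine (hmin _ (hG.mono hle) ?_).of_graph hset.ge ?_
  · apply Set.ncard_lt_ncard _ (Set.toFinite _)
    rw [edgeSet_ssubset_edgeSet]
    refine lt_of_le_of_ne hle fun h => ?_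
    obtain ⟨w, hw⟩ := (G.degree_pos_iff_exists_adj v).1 hv
    have : s(v, w) ∈ (G.deleteEdges (G.incidenceSet v)).edgeSet := by rw [h]; exact hw
    rw [hset] at this
    exact this.2 (Sym2.mem_mk_left _ _)
  · rintro e ⟨he, hve⟩ e' ⟨he', hve'⟩ - ⟨x, hx, y, hy, hxy⟩
    refine ⟨x, hx, y, hy, ?_⟩
    rw [← mem_edgeSet, hset]
    refine ⟨hxy, fun h => ?_⟩
    rcases Sym2.mem_iff.1 h with rfl | rfl
    · exact hve hx
    · exact hve' hy

theorem exists_other_of_degree_two {V : Type*} [Fintype V] {G : SimpleGraph V} {v u : V}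
    (hv : G.degree v = 2) (hu : G.Adj v u) :
    ∃ w, w ≠ u ∧ G.Adj v w ∧ G.neighborFinset v = {u, w} := by
  have h1 : #((G.neighborFinset v).erase u) = 1 := by
    rw [card_erase_of_mem ((mem_neighborFinset _ _ _).2 hu), card_neighborFinset_eq_degree, hv]
  obtain ⟨w, hw⟩ := card_eq_one.1 h1
  have h2 : w ∈ (G.neighborFinset v).erase u := by rw [hw]; exact mem_singleton_self _
  rw [mem_erase, mem_neighborFinset] at h2
  refine ⟨w, h2.1, h2.2, ?_⟩
  rw [← insert_erase ((mem_neighborFinset G v u).2 hu), hw]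

theorem adj_iff_of_neighborFinset {V : Type*} [Fintype V] {G : SimpleGraph V} {v u w : V}
    (h : G.neighborFinset v = {u, w}) (z : V) : G.Adj v z ↔ z = u ∨ z = w := by
  rw [← mem_neighborFinset, h, mem_insert, mem_singleton]

/-- Deleting an edge between two 2-vertices of a triangle does not affect nearness of the other
edges. -/
theorem colorableOn_of_triangle {V : Type*} [Fintype V] {D : ℕ} {G : SimpleGraph V}
    (hG : Good D G) (hmin : SmallerColorable D G) {w v u : V} (hv : G.degree v = 2)
    (hu : G.degree u = 2) (hwv : G.Adj w v) (hvu : G.Adj v u) (hwu : G.Adj w u) :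
    ColorableOn G (G.edgeSet \ {s(v, u)}) (3 * D) := by
  have hset : (G.deleteEdges {s(v, u)}).edgeSet = G.edgeSet \ {s(v, u)} := edgeSet_deleteEdges _
  have hle : G.deleteEdges {s(v, u)} ≤ G := deleteEdges_le _
  obtain ⟨v', hv1, hv2, hv3⟩ := exists_other_of_degree_two hv hvu
  obtain ⟨u', hu1, hu2, hu3⟩ := exists_other_of_degree_two hu hvu.symm
  have hNv := adj_iff_of_neighborFinset hv3
  have hNu := adj_iff_of_neighborFinset hu3
  have hwv' : w = v' := ((hNv w).1 hwv.symm).resolve_left hwu.ne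
  have hwu' : w = u' := ((hNu w).1 hwu.symm).resolve_left hwv.ne
  subst hwv'
  subst hwu'
  refine (hmin _ (hG.mono hle) ?_).of_graph hset.ge ?_
  · apply Set.ncard_lt_ncard _ (Set.toFinite _)
    rw [hset]
    exact ⟨Set.sdiff_subset, fun h => (h hvu).2 rfl⟩
  · have key : ∀ e ∈ G.edgeSet, e ≠ s(v, u) → v ∈ e → e = s(v, w) := by
      rintro e he hne hve
      obtain ⟨z, rfl⟩ := Sym2.mem_iff_exists.1 hve
      rcases (hNv z).1 he with rfl | rfl
      · exact (hne rfl).elim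
      · rfl
    have key' : ∀ e ∈ G.edgeSet, e ≠ s(v, u) → u ∈ e → e = s(u, w) := by
      rintro e he hne hve
      obtain ⟨z, rfl⟩ := Sym2.mem_iff_exists.1 hve
      rcases (hNu z).1 he with rfl | rfl
      · exact (hne Sym2.eq_swap).elim
      · rfl
    have hwv2 : (G.deleteEdges {s(v, u)}).Adj v w := by
      rw [deleteEdges_adj]
      refine ⟨hwv.symm, fun h => ?_⟩
      have := Sym2.congr_right.1 h
      exact hwu.ne this
    rintro e ⟨he, hve⟩ e' ⟨he', hve'⟩ - ⟨x, hx, y, hy, hxy⟩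
    by_cases hne : s(x, y) = s(v, u)
    · rcases Sym2.eq_iff.1 hne with ⟨rfl, rfl⟩ | ⟨rfl, rfl⟩
      · rw [key e he hve hx, key' e' he' hve' hy]
        exact ⟨x, Sym2.mem_mk_left _ _, w, Sym2.mem_mk_right _ _, hwv2⟩
      · rw [key' e he hve hx, key e' he' hve' hy]
        exact ⟨w, Sym2.mem_mk_right _ _, y, Sym2.mem_mk_left _ _, hwv2.symm⟩
    · exact ⟨x, hx, y, hy, by rw [deleteEdges_adj]; exact ⟨hxy, hne⟩⟩

/-! ### Rewiring two links -/

section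

/-- The configuration of two paths `w v₁ u₁ x₁` and `w v₂ u₂ x₂` whose inner vertices have
degree two. -/
structure TwoLinks {V : Type*} (G : SimpleGraph V) (w v₁ v₂ u₁ u₂ x₁ x₂ : V) :
    Prop where
  nv₁ : ∀ z, G.Adj v₁ z ↔ z = w ∨ z = u₁
  nv₂ : ∀ z, G.Adj v₂ z ↔ z = w ∨ z = u₂
  nu₁ : ∀ z, G.Adj u₁ z ↔ z = v₁ ∨ z = x₁
  nu₂ : ∀ z, G.Adj u₂ z ↔ z = v₂ ∨ z = x₂
  v_ne : v₁ ≠ v₂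
  u_ne : u₁ ≠ u₂
  v₁u₂ : v₁ ≠ u₂
  v₂u₁ : v₂ ≠ u₁
  x₁v₂ : x₁ ≠ v₂
  x₂v₁ : x₂ ≠ v₁
  x₁u₂ : x₁ ≠ u₂
  x₂u₁ : x₂ ≠ u₁
  x₁v₁ : x₁ ≠ v₁
  x₂v₂ : x₂ ≠ v₂
  wu₁ : w ≠ u₁
  wu₂ : w ≠ u₂

/-- Replace the edges `v₁u₁` and `v₂u₂` by `u₁u₂`. -/
def rewire {V : Type*} (G : SimpleGraph V) (v₁ v₂ u₁ u₂ : V) : SimpleGraph V :=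
  G.deleteEdges {s(v₁, u₁), s(v₂, u₂)} ⊔ edge u₁ u₂

variable {V : Type*} {G : SimpleGraph V} {w v₁ v₂ u₁ u₂ x₁ x₂ : V}

theorem rewire_adj (hu : u₁ ≠ u₂) (a b : V) : (rewire G v₁ v₂ u₁ u₂).Adj a b ↔
    (G.Adj a b ∧ s(a, b) ≠ s(v₁, u₁) ∧ s(a, b) ≠ s(v₂, u₂)) ∨ s(a, b) = s(u₁, u₂) := by
  rw [rewire, sup_adj, deleteEdges_adj, edge_adj, Set.mem_insert_iff, Set.mem_singleton_iff,
    not_or, Sym2.eq_iff (x := a) (y := b) (z := u₁) (w := u₂)]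
  constructor
  · rintro (h | h)
    · exact Or.inl h
    · exact Or.inr (by tauto)
  · rintro (h | h)
    · exact Or.inl h
    · refine Or.inr ⟨by tauto, ?_⟩
      rintro rfl
      rcases h with ⟨rfl, rfl⟩ | ⟨rfl, rfl⟩ <;> exact hu rfl

theorem rewire_edgeSet (hu : u₁ ≠ u₂) : (rewire G v₁ v₂ u₁ u₂).edgeSet =
    insert s(u₁, u₂) (G.edgeSet \ {s(v₁, u₁), s(v₂, u₂)}) := by
  ext e
  induction e with
  | h a b =>
    rw [mem_edgeSet, rewire_adj hu]
    simp only [Set.mem_insert_iff, Set.mem_sdiff, mem_edgeSet, Set.mem_singleton_iff, not_or]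
    tauto

theorem TwoLinks.rewire_nu₁ (h : TwoLinks G w v₁ v₂ u₁ u₂ x₁ x₂) (z : V) :
    (rewire G v₁ v₂ u₁ u₂).Adj u₁ z → z = x₁ ∨ z = u₂ := by
  rw [rewire_adj h.u_ne, h.nu₁]
  simp only [ne_eq, Sym2.eq_iff]
  have := h.u_ne
  tauto

theorem TwoLinks.rewire_nu₂ (h : TwoLinks G w v₁ v₂ u₁ u₂ x₁ x₂) (z : V) :
    (rewire G v₁ v₂ u₁ u₂).Adj u₂ z → z = x₂ ∨ z = u₁ := by
  rw [rewire_adj h.u_ne, h.nu₂]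
  simp only [ne_eq, Sym2.eq_iff]
  have := h.u_ne
  tauto

theorem TwoLinks.rewire_nv₁ (h : TwoLinks G w v₁ v₂ u₁ u₂ x₁ x₂) (z : V) :
    (rewire G v₁ v₂ u₁ u₂).Adj v₁ z ↔ z = w := by
  rw [rewire_adj h.u_ne, h.nv₁]
  simp only [ne_eq, Sym2.eq_iff]
  have h1 := h.v_ne
  have h2 := h.v₁u₂
  have h3 := h.wu₁
  have h4 := (G.ne_of_adj ((h.nv₁ u₁).2 (Or.inr rfl)))
  constructor
  · tauto
  · rintro rfl
    tauto

theorem TwoLinks.rewire_nv₂ (h : TwoLinks G w v₁ v₂ u₁ u₂ x₁ x₂) (z : V) :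
    (rewire G v₁ v₂ u₁ u₂).Adj v₂ z ↔ z = w := by
  rw [rewire_adj h.u_ne, h.nv₂]
  simp only [ne_eq, Sym2.eq_iff]
  have h1 := h.v_ne
  have h2 := h.v₂u₁
  have h3 := h.wu₂
  have h4 := (G.ne_of_adj ((h.nv₂ u₂).2 (Or.inr rfl)))
  constructor
  · tauto
  · rintro rfl
    tauto

theorem rewire_adj_of_ne (hu : u₁ ≠ u₂) {a b : V} (ha : a ≠ u₁) (ha' : a ≠ u₂)
    (h : (rewire G v₁ v₂ u₁ u₂).Adj a b) : G.Adj a b := by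
  rw [rewire_adj hu, Sym2.eq_iff (x := a) (y := b) (z := u₁) (w := u₂)] at h
  tauto

theorem card_le_two_of_subset_pair {s : Finset V} {a b : V} (h : ∀ z ∈ s, z = a ∨ z = b) :
    #s ≤ 2 := by
  have h1 : s ⊆ {a, b} := fun z hz => by
    rw [mem_insert, mem_singleton]
    exact h z hz
  exact (card_le_card h1).trans card_le_two

/-- Nearness is lost only when its witness is a removed edge `vᵢuᵢ`, and then the two edges are
`vᵢw` and `uᵢxᵢ`; the two extra hypotheses cover exactly these pairs. -/
theorem TwoLinks.properOn (h : TwoLinks G w v₁ v₂ u₁ u₂ x₁ x₂) {N : ℕ} {f : Sym2 V → Fin N}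
    (hf : ProperOn (rewire G v₁ v₂ u₁ u₂) (rewire G v₁ v₂ u₁ u₂).edgeSet f)
    (h1 : f s(v₁, w) ≠ f s(u₁, x₁)) (h2 : f s(v₂, w) ≠ f s(u₂, x₂)) :
    ProperOn G (G.edgeSet \ {s(v₁, u₁), s(v₂, u₂)}) f := by
  have hX : G.edgeSet \ {s(v₁, u₁), s(v₂, u₂)} ⊆ (rewire G v₁ v₂ u₁ u₂).edgeSet := by
    rw [rewire_edgeSet h.u_ne]
    exact Set.subset_insert _ _
  have kv₁ : ∀ e ∈ G.edgeSet \ {s(v₁, u₁), s(v₂, u₂)}, v₁ ∈ e → e = s(v₁, w) := by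
    rintro e he hv
    obtain ⟨z, rfl⟩ := Sym2.mem_iff_exists.1 hv
    rw [(h.rewire_nv₁ z).1 (hX he)]
  have kv₂ : ∀ e ∈ G.edgeSet \ {s(v₁, u₁), s(v₂, u₂)}, v₂ ∈ e → e = s(v₂, w) := by
    rintro e he hv
    obtain ⟨z, rfl⟩ := Sym2.mem_iff_exists.1 hv
    rw [(h.rewire_nv₂ z).1 (hX he)]
  have ku₁ : ∀ e ∈ G.edgeSet \ {s(v₁, u₁), s(v₂, u₂)}, u₁ ∈ e → e = s(u₁, x₁) := by
    rintro e he hv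
    obtain ⟨z, rfl⟩ := Sym2.mem_iff_exists.1 hv
    rcases (h.nu₁ z).1 he.1 with rfl | rfl
    · exact (he.2 (Or.inl Sym2.eq_swap)).elim
    · rfl
  have ku₂ : ∀ e ∈ G.edgeSet \ {s(v₁, u₁), s(v₂, u₂)}, u₂ ∈ e → e = s(u₂, x₂) := by
    rintro e he hv
    obtain ⟨z, rfl⟩ := Sym2.mem_iff_exists.1 hv
    rcases (h.nu₂ z).1 he.1 with rfl | rfl
    · exact (he.2 (Or.inr Sym2.eq_swap)).elim
    · rfl
  rintro e he e' he' hne ⟨x, hx, y, hy, hxy⟩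
  by_cases c1 : s(x, y) = s(v₁, u₁)
  · rcases Sym2.eq_iff.1 c1 with ⟨rfl, rfl⟩ | ⟨rfl, rfl⟩
    · rw [kv₁ e he hx, ku₁ e' he' hy]; exact h1
    · rw [ku₁ e he hx, kv₁ e' he' hy]; exact h1.symm
  by_cases c2 : s(x, y) = s(v₂, u₂)
  · rcases Sym2.eq_iff.1 c2 with ⟨rfl, rfl⟩ | ⟨rfl, rfl⟩
    · rw [kv₂ e he hx, ku₂ e' he' hy]; exact h2
    · rw [ku₂ e he hx, kv₂ e' he' hy]; exact h2.symm
  exact hf e (hX he) e' (hX he') hne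
    ⟨x, hx, y, hy, (rewire_adj h.u_ne _ _).2 (Or.inl ⟨hxy, c1, c2⟩)⟩

theorem ProperOn.comp_of_adj {H : SimpleGraph V} {N : ℕ} {f : Sym2 V → Fin N}
    (hf : ProperOn H H.edgeSet f) (τ : V ≃ V) (hτ : ∀ a b, H.Adj a b → H.Adj (τ a) (τ b)) :
    ProperOn H H.edgeSet (fun e => f (e.map τ)) := by
  have hE : ∀ e ∈ H.edgeSet, e.map τ ∈ H.edgeSet := by
    intro e he
    induction e with
    | h a b => exact hτ a b he
  rintro e he e' he' hne ⟨x, hx, y, hy, hxy⟩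
  refine hf _ (hE e he) _ (hE e' he') (fun h => hne (Sym2.map.injective τ.injective h)) ?_
  exact ⟨τ x, Sym2.mem_map.2 ⟨x, hx, rfl⟩, τ y, Sym2.mem_map.2 ⟨y, hy, rfl⟩, hτ x y hxy⟩

/-- After rewiring, `v₁` and `v₂` are both leaves at `w`, so exchanging them is an automorphism. -/
theorem TwoLinks.swap_adj (h : TwoLinks G w v₁ v₂ u₁ u₂ x₁ x₂) (a b : V)
    (hab : (rewire G v₁ v₂ u₁ u₂).Adj a b) :
    (rewire G v₁ v₂ u₁ u₂).Adj (Equiv.swap v₁ v₂ a) (Equiv.swap v₁ v₂ b) := by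
  have hw1 : w ≠ v₁ := ((h.rewire_nv₁ w).2 rfl).ne'
  have hw2 : w ≠ v₂ := ((h.rewire_nv₂ w).2 rfl).ne'
  have hw : Equiv.swap v₁ v₂ w = w := Equiv.swap_apply_of_ne_of_ne hw1 hw2
  have key : ∀ c d, (rewire G v₁ v₂ u₁ u₂).Adj c d → c = v₁ ∨ c = v₂ →
      (rewire G v₁ v₂ u₁ u₂).Adj (Equiv.swap v₁ v₂ c) (Equiv.swap v₁ v₂ d) := by
    rintro c d hcd (rfl | rfl)
    · rw [(h.rewire_nv₁ d).1 hcd, Equiv.swap_apply_left, hw, h.rewire_nv₂]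
    · rw [(h.rewire_nv₂ d).1 hcd, Equiv.swap_apply_right, hw, h.rewire_nv₁]
  by_cases ha : a = v₁ ∨ a = v₂
  · exact key a b hab ha
  by_cases hb : b = v₁ ∨ b = v₂
  · exact (key b a hab.symm hb).symm
  rw [not_or] at ha hb
  rwa [Equiv.swap_apply_of_ne_of_ne ha.1 ha.2, Equiv.swap_apply_of_ne_of_ne hb.1 hb.2]

variable [Fintype V]

theorem TwoLinks.degree_rewire_u₁ (h : TwoLinks G w v₁ v₂ u₁ u₂ x₁ x₂) :
    (rewire G v₁ v₂ u₁ u₂).degree u₁ ≤ 2 := by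
  rw [← card_neighborFinset_eq_degree]
  exact card_le_two_of_subset_pair fun z hz =>
    h.rewire_nu₁ z ((mem_neighborFinset _ _ _).1 hz)

theorem TwoLinks.degree_rewire_u₂ (h : TwoLinks G w v₁ v₂ u₁ u₂ x₁ x₂) :
    (rewire G v₁ v₂ u₁ u₂).degree u₂ ≤ 2 := by
  rw [← card_neighborFinset_eq_degree]
  exact card_le_two_of_subset_pair fun z hz =>
    h.rewire_nu₂ z ((mem_neighborFinset _ _ _).1 hz)

/-- In the new graph `u₁` and `u₂` have degree at most two, so no 3-regular subgraph uses the new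
edge. For sparseness, dropping both from a vertex set costs two vertices and at most three edges,
exactly the permitted ratio. -/
theorem TwoLinks.good_rewire {D : ℕ} (h : TwoLinks G w v₁ v₂ u₁ u₂ x₁ x₂) (hG : Good D G)
    (hD : 2 ≤ D) : Good D (rewire G v₁ v₂ u₁ u₂) where
  degree_le v := by
    by_cases h1 : v = u₁
    · rw [h1]; exact h.degree_rewire_u₁.trans hD
    by_cases h2 : v = u₂
    · rw [h2]; exact h.degree_rewire_u₂.trans hD
    refine le_trans ?_ (hG.degree_le v)
    rw [← card_neighborFinset_eq_degree, ← card_neighborFinset_eq_degree]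
    refine card_le_card fun z hz => ?_
    rw [mem_neighborFinset] at hz ⊢
    exact rewire_adj_of_ne h.u_ne h1 h2 hz
  sparse S := by
    by_cases hS : u₁ ∈ S ∧ u₂ ∈ S
    · obtain ⟨hS1, hS2⟩ := hS
      have hsub : ({e ∈ (rewire G v₁ v₂ u₁ u₂).edgeFinset | ∀ x ∈ e, x ∈ S} : Finset _) ⊆
          ({e ∈ G.edgeFinset | ∀ x ∈ e, x ∈ (S.erase u₁).erase u₂} : Finset _) ∪
            {s(u₁, x₁), s(u₂, x₂), s(u₁, u₂)} := by
        intro e he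
        rw [mem_filter, mem_edgeFinset] at he
        obtain ⟨he, heS⟩ := he
        simp only [mem_union, mem_filter, mem_edgeFinset, mem_erase, mem_insert, mem_singleton]
        by_cases h1 : u₁ ∈ e
        · obtain ⟨z, rfl⟩ := Sym2.mem_iff_exists.1 h1
          rcases h.rewire_nu₁ z he with rfl | rfl <;> simp
        by_cases h2 : u₂ ∈ e
        · obtain ⟨z, rfl⟩ := Sym2.mem_iff_exists.1 h2
          rcases h.rewire_nu₂ z he with rfl | rfl <;> simp [Sym2.eq_swap]
        refine Or.inl ⟨?_, fun x hx => ⟨?_, ?_, heS x hx⟩⟩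
        · rw [rewire_edgeSet h.u_ne] at he
          rcases he with rfl | he
          · exact (h1 (Sym2.mem_mk_left _ _)).elim
          · exact he.1
        · rintro rfl; exact h2 hx
        · rintro rfl; exact h1 hx
      have h1 := (card_le_card hsub).trans (card_union_le _ _)
      have h2 := hG.sparse ((S.erase u₁).erase u₂)
      have h3 : #((S.erase u₁).erase u₂) + 2 = #S := by
        have h4 := card_erase_add_one hS1
        have h5 := card_erase_add_one (mem_erase.2 ⟨h.u_ne.symm, hS2⟩)
        omega
      have h4 : #({s(u₁, x₁), s(u₂, x₂), s(u₁, u₂)} : Finset (Sym2 V)) ≤ 3 := card_le_three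
      omega
    · refine le_trans ?_ (hG.sparse S)
      gcongr 2 * ?_
      refine card_le_card fun e he => ?_
      rw [mem_filter, mem_edgeFinset] at he ⊢
      refine ⟨?_, he.2⟩
      have he1 := he.1
      rw [rewire_edgeSet h.u_ne] at he1
      rcases he1 with rfl | he1
      · exact (hS ⟨he.2 _ (Sym2.mem_mk_left _ _), he.2 _ (Sym2.mem_mk_right _ _)⟩).elim
      · exact he1.1
  noReg H hH hreg := by
    refine hG.noReg H ?_ hreg
    have h1 : H.degree u₁ = 0 := by
      have := (degree_le_of_le hH (v := u₁)).trans h.degree_rewire_u₁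
      rcases hreg u₁ with h | h <;> omega
    have h2 : H.degree u₂ = 0 := by
      have := (degree_le_of_le hH (v := u₂)).trans h.degree_rewire_u₂
      rcases hreg u₂ with h | h <;> omega
    intro a b hab
    refine rewire_adj_of_ne h.u_ne ?_ ?_ (hH hab)
    · rintro rfl
      exact (H.degree_pos_iff_exists_adj a).2 ⟨b, hab⟩ |>.ne' h1
    · rintro rfl
      exact (H.degree_pos_iff_exists_adj a).2 ⟨b, hab⟩ |>.ne' h2

theorem TwoLinks.ncard_rewire (h : TwoLinks G w v₁ v₂ u₁ u₂ x₁ x₂) :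
    (rewire G v₁ v₂ u₁ u₂).edgeSet.ncard < G.edgeSet.ncard := by
  have hsub : ({s(v₁, u₁), s(v₂, u₂)} : Set (Sym2 V)) ⊆ G.edgeSet := by
    rintro e (rfl | rfl)
    · exact (h.nv₁ u₁).2 (Or.inr rfl)
    · exact (h.nv₂ u₂).2 (Or.inr rfl)
  have hne : s(v₁, u₁) ≠ s(v₂, u₂) := by
    rw [Ne, Sym2.eq_iff]
    have h1 := h.v_ne
    have h2 := h.v₁u₂
    tauto
  rw [rewire_edgeSet h.u_ne]
  have h1 := Set.ncard_insert_le s(u₁, u₂) (G.edgeSet \ {s(v₁, u₁), s(v₂, u₂)})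
  have h2 := Set.ncard_sdiff_add_ncard_of_subset hsub
  rw [Set.ncard_pair hne] at h2
  omega

/-- The edges `v₁w` and `v₂w` get distinct colors, and so do `u₁x₁` and `u₂x₂` because of the new
edge. Hence if `vᵢw` and `uᵢxᵢ` agree for some `i`, exchanging the colors of `v₁w` and `v₂w` removes
every conflict. -/
theorem TwoLinks.colorableOn (h : TwoLinks G w v₁ v₂ u₁ u₂ x₁ x₂) {D : ℕ} (hG : Good D G)
    (hD : 2 ≤ D) (hmin : SmallerColorable D G) :
    ColorableOn G (G.edgeSet \ {s(v₁, u₁), s(v₂, u₂)}) (3 * D) := by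
  obtain ⟨f, hf⟩ := hmin _ (h.good_rewire hG hD) h.ncard_rewire
  have a1 := (h.rewire_nv₁ w).2 rfl
  have a2 := (h.rewire_nv₂ w).2 rfl
  have hux₁ : s(u₁, x₁) ∈ (rewire G v₁ v₂ u₁ u₂).edgeSet := by
    rw [mem_edgeSet, rewire_adj h.u_ne]
    refine Or.inl ⟨(h.nu₁ x₁).2 (Or.inr rfl), ?_, ?_⟩ <;> rw [Ne, Sym2.eq_iff]
    · have h1 := h.x₁v₁
      have h2 := ((h.nu₁ v₁).2 (Or.inl rfl)).ne
      tauto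
    · have := h.x₁v₂; have := h.x₁u₂; tauto
  have hux₂ : s(u₂, x₂) ∈ (rewire G v₁ v₂ u₁ u₂).edgeSet := by
    rw [mem_edgeSet, rewire_adj h.u_ne]
    refine Or.inl ⟨(h.nu₂ x₂).2 (Or.inr rfl), ?_, ?_⟩ <;> rw [Ne, Sym2.eq_iff]
    · have := h.x₂v₁; have := h.x₂u₁; tauto
    · have h1 := h.x₂v₂
      have h2 := ((h.nu₂ v₂).2 (Or.inl rfl)).ne
      tauto
  have hv : f s(v₁, w) ≠ f s(v₂, w) := by
    refine hf _ a1 _ a2 (fun h' => h.v_ne (Sym2.congr_left.1 h')) ?_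
    exact ⟨v₁, Sym2.mem_mk_left _ _, w, Sym2.mem_mk_right _ _, a1⟩
  have hu : f s(u₁, x₁) ≠ f s(u₂, x₂) := by
    refine hf _ hux₁ _ hux₂ (fun h' => ?_) ?_
    · rw [Sym2.eq_iff] at h'
      have h1 := h.u_ne
      have h2 := h.x₁u₂
      tauto
    · exact ⟨u₁, Sym2.mem_mk_left _ _, u₂, Sym2.mem_mk_left _ _,
        (rewire_adj h.u_ne _ _).2 (Or.inr rfl)⟩
  by_cases hc : f s(v₁, w) ≠ f s(u₁, x₁) ∧ f s(v₂, w) ≠ f s(u₂, x₂)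
  · exact ⟨f, h.properOn hf hc.1 hc.2⟩
  · refine ⟨_, h.properOn (hf.comp_of_adj (Equiv.swap v₁ v₂) h.swap_adj) ?_ ?_⟩
    · have e1 : Equiv.swap v₁ v₂ w = w := Equiv.swap_apply_of_ne_of_ne a1.ne' a2.ne'
      have e2 : Equiv.swap v₁ v₂ u₁ = u₁ := Equiv.swap_apply_of_ne_of_ne
        ((h.nu₁ v₁).2 (Or.inl rfl)).ne h.v₂u₁.symm
      have e3 : Equiv.swap v₁ v₂ x₁ = x₁ := Equiv.swap_apply_of_ne_of_ne h.x₁v₁ h.x₁v₂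
      simp only [Sym2.map_mk, e1, e2, e3, Equiv.swap_apply_left]
      intro h3
      rw [not_and_or, not_ne_iff, not_ne_iff] at hc
      rcases hc with hc | hc
      · exact hv (hc.trans h3.symm)
      · exact hu (h3.symm.trans hc)
    · have e1 : Equiv.swap v₁ v₂ w = w := Equiv.swap_apply_of_ne_of_ne a1.ne' a2.ne'
      have e2 : Equiv.swap v₁ v₂ u₂ = u₂ := Equiv.swap_apply_of_ne_of_ne
        h.v₁u₂.symm ((h.nu₂ v₂).2 (Or.inl rfl)).ne
      have e3 : Equiv.swap v₁ v₂ x₂ = x₂ := Equiv.swap_apply_of_ne_of_ne h.x₂v₁ h.x₂v₂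
      simp only [Sym2.map_mk, e1, e2, e3, Equiv.swap_apply_right]
      intro h3
      rw [not_and_or, not_ne_iff, not_ne_iff] at hc
      rcases hc with hc | hc
      · exact hu (hc.symm.trans h3)
      · exact hv (h3.trans hc.symm)

end

/-! ### Extracting the core from a minimal counterexample -/

theorem nbrSum_pair {V : Type*} [Fintype V] {G : SimpleGraph V} (K : SimpleGraph V) {v u w : V}
    (h : G.neighborFinset v = {u, w}) (hne : w ≠ u) :
    nbrSum G K v = K.degree u + K.degree w := by
  rw [nbrSum, h, sum_pair hne.symm]

/-- After cancellation the edge inequality leaves `3D` at most the sum of the `K`-degrees of the two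
outer neighbors, which is at most `2D`. -/
theorem not_adj_of_degree_two {V : Type*} [Fintype V] {D : ℕ} {G K : SimpleGraph V}
    (hG : Good D G) (hD : 1 ≤ D) (hle : K ≤ G)
    (hedge : ∀ u w, K.Adj u w →
      3 * D + K.degree u + K.degree w ≤ nbrSum G K u + nbrSum G K w)
    {u v : V} (hu : G.degree u = 2) (hv : G.degree v = 2) : ¬ K.Adj u v := by
  intro h
  obtain ⟨a, ha1, -, ha3⟩ := exists_other_of_degree_two hu (hle h)
  obtain ⟨b, hb1, -, hb3⟩ := exists_other_of_degree_two hv (hle h).symm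
  have h1 := hedge u v h
  rw [nbrSum_pair K ha3 ha1, nbrSum_pair K hb3 hb1] at h1
  have h2 := (degree_le_of_le hle (v := a)).trans (hG.degree_le a)
  have h3 := (degree_le_of_le hle (v := b)).trans (hG.degree_le b)
  omega

theorem exists_core_graph {V : Type*} [Fintype V] {D : ℕ} {G : SimpleGraph V} (hG : Good D G)
    (hD : 2 ≤ D) (hmin : SmallerColorable D G) (hn : ¬ ColorableOn G G.edgeSet (3 * D)) :
    ∃ K, Core D G K := by
  rw [← coe_edgeFinset] at hn
  obtain ⟨K₀, hK₀, hnc, hcore⟩ := exists_core hn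
  obtain ⟨K, hK⟩ : ∃ K : SimpleGraph V, K.edgeSet = (K₀ : Set (Sym2 V)) := by
    refine ⟨fromEdgeSet (K₀ : Set (Sym2 V)), ?_⟩
    ext e
    rw [edgeSet_fromEdgeSet, Set.mem_sdiff, mem_coe]
    exact ⟨fun h => h.1, fun h => ⟨h, G.not_isDiag_of_mem_edgeSet (mem_edgeFinset.1 (hK₀ h))⟩⟩
  obtain rfl : K.edgeFinset = K₀ := by
    rw [← coe_inj, coe_edgeFinset, hK]
  rw [coe_edgeFinset] at hnc
  have hle : K ≤ G := edgeFinset_subset_edgeFinset.1 hK₀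
  have hleE : K.edgeSet ⊆ G.edgeSet := edgeSet_subset_edgeSet.2 hle
  have hedge : ∀ u w, K.Adj u w →
      3 * D + K.degree u + K.degree w ≤ nbrSum G K u + nbrSum G K w := by
    intro u w h
    have h1 := card_near_le hle h
    have h2 := hcore s(u, w) (mem_edgeFinset.2 h)
    omega
  have hpos : ∀ v, 0 < G.degree v → 0 < K.degree v := by
    intro v hv
    rw [pos_iff_ne_zero]
    intro h0
    refine hnc ((colorableOn_of_not_mem hG hmin hv).mono fun e he => ⟨hleE he, fun hve => ?_⟩)
    obtain ⟨z, rfl⟩ := Sym2.mem_iff_exists.1 hve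
    exact (K.degree_pos_iff_exists_adj v).2 ⟨z, he⟩ |>.ne' h0
  have h22 : ∀ u v, G.degree u = 2 → G.degree v = 2 → ¬ K.Adj u v := fun u v hu hv =>
    not_adj_of_degree_two hG (by omega) hle hedge hu hv
  have htri : ∀ w v u, G.degree v = 2 → G.degree u = 2 → G.Adj w v → G.Adj v u →
      ¬ G.Adj w u := by
    intro w v u hv hu hwv hvu hwu
    refine hnc ((colorableOn_of_triangle hG hmin hv hu hwv hvu hwu).mono fun e he =>
      ⟨hleE he, ?_⟩)
    rintro rfl
    exact h22 v u hv hu he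
  -- If both neighbors of `u` had degree two, `K` would have no edge at `u`, contradicting `hpos`.
  have hother : ∀ v u, G.degree v = 2 → G.degree u = 2 → G.Adj v u →
      ∃ x, x ≠ v ∧ G.degree x ≠ 2 ∧ G.neighborFinset u = {v, x} := by
    intro v u hv hu hvu
    obtain ⟨x, hx1, hx2, hx3⟩ := exists_other_of_degree_two hu hvu.symm
    refine ⟨x, hx1, fun hx => ?_, hx3⟩
    obtain ⟨z, hz⟩ := (K.degree_pos_iff_exists_adj u).1 (hpos u (by omega))
    rcases (adj_iff_of_neighborFinset hx3 z).1 (hle hz) with rfl | rfl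
    · exact h22 _ _ hu hv hz
    · exact h22 _ _ hu hx hz
  refine ⟨K, hG, hle, ?_, hpos, hedge, ?_⟩
  · rintro rfl
    -- Even coloring the empty set requires a map into `Fin (3 * D)`, hence a positive number of
    -- colors.
    refine hnc ⟨fun _ => ⟨0, by omega⟩, fun e he => ?_⟩
    simp at he
  · intro w v₁ v₂ u₁ u₂ hv₁ hv₂ hu₁ hu₂ hwv₁ hwv₂ hvu₁ hvu₂ hv hw₁ hw₂
    have t₁ := htri w v₁ u₁ hv₁ hu₁ hwv₁ hvu₁
    have t₂ := htri w v₂ u₂ hv₂ hu₂ hwv₂ hvu₂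
    obtain ⟨x₁, hx₁, hdx₁, hNu₁⟩ := hother v₁ u₁ hv₁ hu₁ hvu₁
    obtain ⟨x₂, hx₂, hdx₂, hNu₂⟩ := hother v₂ u₂ hv₂ hu₂ hvu₂
    have nv : ∀ v u, G.degree v = 2 → G.Adj w v → G.Adj v u → u ≠ w →
        ∀ z, G.Adj v z ↔ z = w ∨ z = u := by
      intro v u hdv hwv hvu huw
      obtain ⟨y, -, -, hy⟩ := exists_other_of_degree_two hdv hwv.symm
      have h1 := adj_iff_of_neighborFinset hy
      rwa [((h1 u).1 hvu).resolve_left huw]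
    have ne2 : ∀ {a b : V}, G.degree a ≠ 2 → G.degree b = 2 → a ≠ b := by
      rintro a b ha hb rfl
      exact ha hb
    have T : TwoLinks G w v₁ v₂ u₁ u₂ x₁ x₂ :=
      { nv₁ := nv v₁ u₁ hv₁ hwv₁ hvu₁ hw₁
        nv₂ := nv v₂ u₂ hv₂ hwv₂ hvu₂ hw₂
        nu₁ := adj_iff_of_neighborFinset hNu₁
        nu₂ := adj_iff_of_neighborFinset hNu₂
        v_ne := hv
        u_ne := by
          rintro rfl
          rcases (adj_iff_of_neighborFinset hNu₁ v₂).1 hvu₂.symm with h | h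
          · exact hv h.symm
          · exact ne2 hdx₁ hv₂ h.symm
        v₁u₂ := by rintro rfl; exact t₂ hwv₁
        v₂u₁ := by rintro rfl; exact t₁ hwv₂
        x₁v₂ := ne2 hdx₁ hv₂
        x₂v₁ := ne2 hdx₂ hv₁
        x₁u₂ := ne2 hdx₁ hu₂
        x₂u₁ := ne2 hdx₂ hu₁
        x₁v₁ := hx₁
        x₂v₂ := hx₂
        wu₁ := hw₁.symm
        wu₂ := hw₂.symm }
    refine hnc ((T.colorableOn hG hD hmin).mono fun e he => ⟨hleE he, ?_⟩)
    rintro (rfl | rfl)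
    · exact h22 _ _ hv₁ hu₁ he
    · exact h22 _ _ hv₂ hu₂ he

/-! ### Degree classes, rich vertices and the surroundings of 2-vertices -/

section

/-- The number of neighbors of `w` of degree `c`. -/
noncomputable def numNbr {V : Type*} [Fintype V] (G : SimpleGraph V) (c : ℕ) (w : V) : ℕ :=
  #{x ∈ G.neighborFinset w | G.degree x = c}

/-- The number of neighbors of `w` of degree at least four. -/
noncomputable def numBig {V : Type*} [Fintype V] (G : SimpleGraph V) (w : V) : ℕ :=
  #{x ∈ G.neighborFinset w | 4 ≤ G.degree x}

/-- A vertex of degree at least four that can afford to give to all its neighbors of degree two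
and three. -/
def Rich {V : Type*} [Fintype V] (G : SimpleGraph V) (w : V) : Prop :=
  4 ≤ G.degree w ∧ 6 ≤ 2 * numBig G w + numNbr G 3 w + numNbr G 2 w

/-- The number of rich neighbors of `w`. -/
noncomputable def numRich {V : Type*} [Fintype V] (G : SimpleGraph V) (w : V) : ℕ :=
  #{x ∈ G.neighborFinset w | Rich G x}

/-- The trivial upper bound, depending on the degree class, for the `K`-degree of a vertex. -/
noncomputable def cap {V : Type*} [Fintype V] (D : ℕ) (G : SimpleGraph V) (x : V) : ℕ :=
  if G.degree x = 1 then 1 else if G.degree x = 2 then 2 else if G.degree x = 3 then 3 else D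

variable {V : Type*} [Fintype V] {D : ℕ} {G K : SimpleGraph V}

theorem one_le_degree_of_mem {w x : V} (hx : x ∈ G.neighborFinset w) : 1 ≤ G.degree x :=
  (G.degree_pos_iff_exists_adj x).2 ⟨w, ((mem_neighborFinset _ _ _).1 hx).symm⟩

theorem degree_eq_sum (G : SimpleGraph V) (w : V) : G.degree w =
    numNbr G 1 w + numNbr G 2 w + numNbr G 3 w + numBig G w := by
  simp only [numNbr, numBig, card_filter, ← sum_add_distrib]
  rw [← card_neighborFinset_eq_degree, card_eq_sum_ones]
  refine sum_congr rfl fun x hx => ?_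
  have := one_le_degree_of_mem hx
  split_ifs <;> omega

theorem sum_cap (D : ℕ) (G : SimpleGraph V) (w : V) : ∑ x ∈ G.neighborFinset w, cap D G x =
    numNbr G 1 w + 2 * numNbr G 2 w + 3 * numNbr G 3 w + D * numBig G w := by
  simp only [numNbr, numBig, card_filter, ← sum_add_distrib, mul_sum]
  refine sum_congr rfl fun x hx => ?_
  have := one_le_degree_of_mem hx
  unfold cap
  split_ifs <;> omega

theorem numNbr_pos {c : ℕ} {w x : V} (hwx : G.Adj w x) (hx : G.degree x = c) :
    0 < numNbr G c w :=
  card_pos.2 ⟨x, mem_filter.2 ⟨(mem_neighborFinset _ _ _).2 hwx, hx⟩⟩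

theorem exists_of_numNbr_pos {c : ℕ} {w : V} (h : 0 < numNbr G c w) :
    ∃ x, G.Adj w x ∧ G.degree x = c := by
  obtain ⟨x, hx⟩ := card_pos.1 h
  rw [mem_filter, mem_neighborFinset] at hx
  exact ⟨x, hx⟩

namespace Core

theorem degree_K_le (h : Core D G K) (x : V) : K.degree x ≤ G.degree x := degree_le_of_le h.le

theorem degree_K_le_D (h : Core D G K) (x : V) : K.degree x ≤ D :=
  (h.degree_K_le x).trans (h.good.degree_le x)

theorem degree_K_le_cap (h : Core D G K) (x : V) : K.degree x ≤ cap D G x := by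
  have h1 := h.degree_K_le x
  have h2 := h.degree_K_le_D x
  unfold cap
  split_ifs <;> omega

theorem nbrSum_le (h : Core D G K) (w : V) : nbrSum G K w ≤
    numNbr G 1 w + 2 * numNbr G 2 w + 3 * numNbr G 3 w + D * numBig G w := by
  rw [← sum_cap]
  exact sum_le_sum fun x _ => h.degree_K_le_cap x

theorem nbrSum_add_cap_le (h : Core D G K) {w v : V} (hwv : G.Adj w v) :
    nbrSum G K w + cap D G v ≤ K.degree v +
      (numNbr G 1 w + 2 * numNbr G 2 w + 3 * numNbr G 3 w + D * numBig G w) := by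
  have hv : v ∈ G.neighborFinset w := (mem_neighborFinset _ _ _).2 hwv
  rw [← sum_cap, nbrSum, ← add_sum_erase _ _ hv, ← add_sum_erase _ _ hv]
  have := sum_le_sum fun x (_ : x ∈ (G.neighborFinset w).erase v) => h.degree_K_le_cap x
  omega

theorem degree_pos_of_adj (h : Core D G K) {w x : V} (hwx : G.Adj w x) : 0 < K.degree w :=
  h.pos w ((G.degree_pos_iff_exists_adj w).2 ⟨x, hwx⟩)

/-- The neighborhood sum of the leaf is just `K.degree w`, which cancels in the edge inequality; the
extra one is the `K`-degree of the leaf. -/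
theorem nbrSum_of_leaf (h : Core D G K) {w x : V} (hwx : G.Adj w x) (hx : G.degree x = 1) :
    3 * D + 1 ≤ nbrSum G K w := by
  have hN : G.neighborFinset x = {w} := by
    obtain ⟨y, hy⟩ := card_eq_one.1 ((G.card_neighborFinset_eq_degree x).trans hx)
    have : w ∈ G.neighborFinset x := (mem_neighborFinset _ _ _).2 hwx.symm
    rw [hy, mem_singleton] at this
    rw [hy, this]
  obtain ⟨y, hy⟩ := (K.degree_pos_iff_exists_adj x).1 (h.degree_pos_of_adj hwx.symm)
  have hyw : y = w := by
    have : y ∈ G.neighborFinset x := (mem_neighborFinset _ _ _).2 (h.le hy)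
    rwa [hN, mem_singleton] at this
  subst hyw
  have h1 := h.edge x y hy
  have h2 : nbrSum G K x = K.degree y := by rw [nbrSum, hN, sum_singleton]
  have h3 := h.degree_pos_of_adj hwx.symm
  omega

theorem nbrSum_of_numNbr_one (h : Core D G K) {w : V} (hw : 0 < numNbr G 1 w) :
    3 * D + 1 ≤ nbrSum G K w := by
  obtain ⟨x, hx⟩ := exists_of_numNbr_pos hw
  exact h.nbrSum_of_leaf hx.1 hx.2

/-- With at most two big neighbors and at most three non-leaf neighbors, the cap bound on the
neighborhood sum is at most `3D`, just short of what a leaf requires. -/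
theorem nonleaf_of_numNbr_one (h : Core D G K) (hD : 7 ≤ D) {w : V} (hw : 0 < numNbr G 1 w) :
    4 ≤ numNbr G 2 w + numNbr G 3 w + numBig G w ∨ 3 ≤ numBig G w := by
  have h1 := h.nbrSum_of_numNbr_one hw
  have h2 := h.nbrSum_le w
  have h3 := h.good.degree_le w
  rw [degree_eq_sum] at h3
  by_contra! hc
  obtain ⟨hc1, hc2⟩ := hc
  generalize numBig G w = b at *
  interval_cases b <;> omega

theorem no_leaf (h : Core D G K) (hD : 7 ≤ D) {w : V} (hw : G.degree w ≤ 3) :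
    numNbr G 1 w = 0 := by
  by_contra hc
  have h1 := h.nonleaf_of_numNbr_one hD (Nat.pos_of_ne_zero hc)
  rw [degree_eq_sum] at hw
  omega

theorem nonleaf_of_big (h : Core D G K) (hD : 7 ≤ D) {w : V} (hw : 4 ≤ G.degree w) :
    4 ≤ numNbr G 2 w + numNbr G 3 w + numBig G w ∨ 3 ≤ numBig G w := by
  rcases Nat.eq_zero_or_pos (numNbr G 1 w) with h0 | h0
  · rw [degree_eq_sum] at hw
    omega
  · exact h.nonleaf_of_numNbr_one hD h0

theorem of_not_rich (h : Core D G K) (hD : 7 ≤ D) {w : V} (hw : 4 ≤ G.degree w)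
    (hr : ¬ Rich G w) : numNbr G 1 w = 0 ∧ numBig G w ≤ 1 ∧ G.degree w ≤ 5 ∧
      2 * numBig G w + numNbr G 3 w + numNbr G 2 w < 6 := by
  have h0 : 2 * numBig G w + numNbr G 3 w + numNbr G 2 w < 6 := by
    by_contra hc
    exact hr ⟨hw, by omega⟩
  have h1 := h.nonleaf_of_big hD hw
  have h2 : numBig G w ≤ 1 := by omega
  have h3 : numNbr G 1 w = 0 := by
    by_contra hc
    have h4 := h.nbrSum_of_numNbr_one (Nat.pos_of_ne_zero hc)
    have h5 := h.nbrSum_le w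
    have h6 := h.good.degree_le w
    rw [degree_eq_sum] at h6
    generalize numBig G w = b at *
    interval_cases b <;> omega
  refine ⟨h3, h2, ?_, h0⟩
  rw [degree_eq_sum]
  omega

theorem rich_of_six_le (h : Core D G K) (hD : 7 ≤ D) {w : V} (hw : 6 ≤ K.degree w) :
    Rich G w := by
  by_contra hr
  have h1 := h.degree_K_le w
  have h2 := h.of_not_rich hD (by omega) hr
  omega

/-- The constraint imposed by a `K`-edge at a vertex of degree two. -/
theorem edge_two (h : Core D G K) {u v w : V} (huv : K.Adj u v)
    (hN : G.neighborFinset v = {u, w}) (hne : w ≠ u) :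
    3 * D + K.degree v ≤ nbrSum G K u + K.degree w := by
  have h1 := h.edge u v huv
  rw [nbrSum_pair K hN hne] at h1
  omega

theorem not_adj_two_two (h : Core D G K) (hD : 7 ≤ D) {u v : V} (hu : G.degree u = 2)
    (hv : G.degree v = 2) : ¬ K.Adj u v :=
  not_adj_of_degree_two h.good (by omega) h.le h.edge hu hv

theorem not_adj_of_not_rich (h : Core D G K) (hD : 7 ≤ D) {u v : V} (hu : 4 ≤ G.degree u)
    (hr : ¬ Rich G u) (hv : G.degree v = 2) : ¬ K.Adj u v := by
  intro huv
  obtain ⟨w, hw1, -, hw3⟩ := exists_other_of_degree_two hv (h.le huv).symm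
  have h1 := h.edge_two huv hw3 hw1
  have h2 := h.nbrSum_add_cap_le (h.le huv)
  have h3 := h.degree_K_le_D w
  obtain ⟨h4, h5, h6, h7⟩ := h.of_not_rich hD hu hr
  have h8 := numNbr_pos (h.le huv) hv
  have h9 : cap D G v = 2 := by simp [cap, hv]
  generalize numBig G u = b at *
  -- Both values of `b` leave `2 * D ≤ 12`, so `D ≥ 7` is exactly what is needed.
  interval_cases b <;> omega

/-- After cancelling the degree of `v`, three vertices remain to supply `3D`: `w` and the two other
neighbors of `u`. Each must therefore attain the maximum `D`. -/
theorem of_three_adj_two (h : Core D G K) (hD : 7 ≤ D) {u v w : V} (hu : G.degree u = 3)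
    (hv : G.degree v = 2) (huv : K.Adj u v) (hN : G.neighborFinset v = {u, w}) (hne : w ≠ u) :
    numNbr G 2 u = 1 ∧ K.degree w = D ∧ ∀ x, G.Adj u x → x ≠ v → K.degree x = D := by
  have h1 := h.edge_two huv hN hne
  have h2 := h.nbrSum_add_cap_le (h.le huv)
  have h3 := h.degree_K_le_D w
  have h8 := numNbr_pos (h.le huv) hv
  have h9 : cap D G v = 2 := by simp [cap, hv]
  have h4 := h.no_leaf hD hu.le
  have h5 := degree_eq_sum G u
  have hmem : v ∈ G.neighborFinset u := (mem_neighborFinset _ _ _).2 (h.le huv)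
  have hb : numBig G u = 2 := by
    have : numBig G u ≤ 2 := by omega
    generalize numBig G u = b at *
    interval_cases b <;> omega
  rw [hb] at h2
  refine ⟨by omega, by omega, fun x hux hxv => ?_⟩
  have hx : x ∈ (G.neighborFinset u).erase v :=
    mem_erase.2 ⟨hxv, (mem_neighborFinset _ _ _).2 hux⟩
  have e1 : nbrSum G K u = K.degree v + (K.degree x +
      ∑ y ∈ ((G.neighborFinset u).erase v).erase x, K.degree y) := by
    rw [nbrSum, ← add_sum_erase _ _ hmem, ← add_sum_erase _ _ hx]
  have e2 : ∑ y ∈ ((G.neighborFinset u).erase v).erase x, K.degree y ≤ 1 * D := by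
    have hc : #(((G.neighborFinset u).erase v).erase x) = 1 := by
      rw [card_erase_of_mem hx, card_erase_of_mem hmem, card_neighborFinset_eq_degree, hu]
    rw [← hc, ← smul_eq_mul]
    exact sum_le_card_nsmul _ _ _ fun y _ => h.degree_K_le_D y
  have e3 := h.degree_K_le_D x
  omega

theorem degree_K_add_numNbr_le (h : Core D G K) {u : V}
    (hu : ∀ v, G.degree v = 2 → ¬ K.Adj u v) : K.degree u + numNbr G 2 u ≤ G.degree u := by
  rw [← card_neighborFinset_eq_degree, ← card_neighborFinset_eq_degree, numNbr,
    ← card_union_of_disjoint]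
  · refine card_le_card (union_subset (fun x hx => ?_) (filter_subset _ _))
    rw [mem_neighborFinset] at hx ⊢
    exact h.le hx
  · rw [Finset.disjoint_left]
    intro x hx hx'
    exact hu x (mem_filter.1 hx').2 ((mem_neighborFinset _ _ _).1 hx)

/-- A vertex of degree two not joined by `K` to one of its neighbors is joined to the other. -/
theorem of_not_adj (h : Core D G K) {u v w : V} (huv : ¬ K.Adj u v)
    (hN : G.neighborFinset v = {u, w}) : K.Adj w v ∧ K.degree v = 1 := by
  have hsub : K.neighborFinset v ⊆ {w} := by
    intro z hz
    rw [mem_neighborFinset] at hz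
    rw [mem_singleton]
    refine ((adj_iff_of_neighborFinset hN z).1 (h.le hz)).resolve_left ?_
    rintro rfl
    exact huv hz.symm
  have h1 := card_le_card hsub
  rw [card_neighborFinset_eq_degree, card_singleton] at h1
  have h2 : 0 < K.degree v :=
    h.degree_pos_of_adj ((adj_iff_of_neighborFinset hN u).2 (Or.inl rfl))
  obtain ⟨z, hz⟩ := (K.degree_pos_iff_exists_adj v).1 h2
  have h3 := mem_singleton.1 (hsub ((mem_neighborFinset _ _ _).2 hz))
  subst h3
  exact ⟨hz.symm, by omega⟩

/-- A `K`-edge at a 2-vertex cannot come from a leaf, a 2-vertex or a non-rich vertex of degree at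
least four; coming from a 3-vertex it forces `K.degree w = D`, which makes `w` rich. -/
theorem rich_of_adj_two (h : Core D G K) (hD : 7 ≤ D) {u v w : V} (hv : G.degree v = 2)
    (huv : K.Adj u v) (hN : G.neighborFinset v = {u, w}) (hne : w ≠ u) :
    Rich G u ∨ Rich G w := by
  by_contra! hc
  have h1 : 1 ≤ G.degree u := (G.degree_pos_iff_exists_adj u).2 ⟨v, h.le huv⟩
  have hu1 : G.degree u ≠ 1 := fun hu => by
    have := numNbr_pos (h.le huv).symm hu
    have := h.no_leaf hD (w := v) (by omega)
    omega
  have hu2 : G.degree u ≠ 2 := fun hu => h.not_adj_two_two hD hu hv huv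
  have hu3 : G.degree u ≠ 3 := fun hu => by
    have := (h.of_three_adj_two hD hu hv huv hN hne).2.1
    exact hc.2 (h.rich_of_six_le hD (by omega))
  exact h.not_adj_of_not_rich hD (by omega) hc.1 hv huv

theorem rich_or_rich (h : Core D G K) (hD : 7 ≤ D) {u v w : V} (hv : G.degree v = 2)
    (hN : G.neighborFinset v = {u, w}) (hne : w ≠ u) : Rich G u ∨ Rich G w := by
  by_cases huv : K.Adj u v
  · exact h.rich_of_adj_two hD hv huv hN hne
  · exact (h.rich_of_adj_two hD hv (h.of_not_adj huv hN).1
      (by rw [hN, pair_comm]) hne.symm).symm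

end Core

end

/-! ### 3-vertices with 2-neighbors, and offers -/

section

variable {V : Type*} [Fintype V] {D : ℕ} {G K : SimpleGraph V}

namespace Core

theorem numRich_pos {w u : V} (hw : Rich G w) (huw : G.Adj u w) : 0 < numRich G u :=
  card_pos.2 ⟨w, mem_filter.2 ⟨(mem_neighborFinset _ _ _).2 huw, hw⟩⟩

theorem numRich_add_numNbr_le (u : V) : numRich G u + numNbr G 2 u ≤ G.degree u := by
  rw [← card_neighborFinset_eq_degree, numRich, numNbr, ← card_union_of_disjoint]
  · exact card_le_card (union_subset (filter_subset _ _) (filter_subset _ _))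
  · rw [Finset.disjoint_left]
    intro x hx hx'
    have h1 := (mem_filter.1 hx).2.1
    have h2 := (mem_filter.1 hx').2
    omega

theorem nbrSum_le_of_not_rich (h : Core D G K) (hD : 7 ≤ D) {x u : V} (hx : ¬ Rich G x)
    (hxu : G.Adj x u) (hu : G.degree u = 3) :
    nbrSum G K x ≤ K.degree u + 2 * D ∧ K.degree x ≤ 5 := by
  have h1 := h.nbrSum_add_cap_le hxu
  have h9 : cap D G u = 3 := by simp [cap, hu]
  have h10 := numNbr_pos hxu hu
  have h11 := degree_eq_sum G x
  have h12 := h.degree_K_le x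
  have h13 : 0 < G.degree x := (G.degree_pos_iff_exists_adj x).2 ⟨u, hxu⟩
  by_cases h4 : 4 ≤ G.degree x
  · obtain ⟨h4, h5, h6, h7⟩ := h.of_not_rich hD h4 hx
    generalize numBig G x = b at *
    interval_cases b <;> omega
  · have hb : numBig G x ≤ 2 := by omega
    generalize numBig G x = b at *
    interval_cases b <;> omega

/-- Vertices of degree three with exactly two, respectively more, neighbors of degree two. -/
theorem three_of_two_le (h : Core D G K) (hD : 7 ≤ D) {u : V} (hu : G.degree u = 3)
    (h2 : 2 ≤ numNbr G 2 u) : numNbr G 2 u = 2 ∧ numRich G u = 1 ∧ K.degree u = 1 := by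
  have hK2 : ∀ v, G.degree v = 2 → ¬ K.Adj u v := by
    intro v hv huv
    obtain ⟨w, hw1, -, hw3⟩ := exists_other_of_degree_two hv (h.le huv).symm
    have := (h.of_three_adj_two hD hu hv huv hw3 hw1).1
    omega
  have h3 := h.degree_K_add_numNbr_le hK2
  have h4 : 0 < K.degree u := h.pos u (by omega)
  obtain ⟨x, hx⟩ := (K.degree_pos_iff_exists_adj u).1 h4
  have hx2 : G.degree x ≠ 2 := fun h' => hK2 x h' hx
  -- If `x` were not rich, its sum is at most `K.degree u + 2 * D`, while the two 2-neighbors of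
  -- `u`, missed by `u` in `K`, have `K`-degree one; this would give `D ≤ 2`.
  have h5 : Rich G x := by
    by_contra hr
    obtain ⟨h6, h7⟩ := h.nbrSum_le_of_not_rich hD hr (h.le hx).symm hu
    have h8 := h.edge u x hx
    have h9 : nbrSum G K u ≤ K.degree x + 2 := by
      have hmem : x ∈ G.neighborFinset u := (mem_neighborFinset _ _ _).2 (h.le hx)
      rw [nbrSum, ← add_sum_erase _ _ hmem]
      have hsub : ({v ∈ G.neighborFinset u | G.degree v = 2} : Finset V) ⊆
          (G.neighborFinset u).erase x := by
        intro v hv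
        rw [mem_filter] at hv
        refine mem_erase.2 ⟨?_, hv.1⟩
        rintro rfl
        exact hx2 hv.2
      have hc : #((G.neighborFinset u).erase x) = 2 := by
        rw [card_erase_of_mem hmem, card_neighborFinset_eq_degree, hu]
      have heq := eq_of_subset_of_card_le hsub (by rw [hc]; exact h2)
      have h10 : ∑ v ∈ (G.neighborFinset u).erase x, K.degree v ≤ 2 * 1 := by
        rw [← hc, ← smul_eq_mul]
        refine sum_le_card_nsmul _ _ _ fun v hv => ?_
        rw [← heq, mem_filter, mem_neighborFinset] at hv
        obtain ⟨w, hw1, -, hw3⟩ := exists_other_of_degree_two hv.2 hv.1.symm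
        exact (h.of_not_adj (hK2 v hv.2) hw3).2.le
      omega
    omega
  have h6 := numRich_pos h5 (h.le hx)
  have h7 := numRich_add_numNbr_le (G := G) u
  omega

/-- Vertices of degree three with exactly one neighbor of degree two. -/
theorem three_of_one (h : Core D G K) (hD : 7 ≤ D) {u v : V} (hu : G.degree u = 3)
    (h2 : numNbr G 2 u = 1) (huv : G.Adj u v) (hv : G.degree v = 2) :
    (numRich G u = 1 ∧ ¬ K.Adj u v ∧ K.degree u ≤ 2) ∨ numRich G u = 2 := by
  have h7 := numRich_add_numNbr_le (G := G) u
  have hmem : v ∈ G.neighborFinset u := (mem_neighborFinset _ _ _).2 huv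
  have hone : ∀ z, G.Adj u z → G.degree z = 2 → z = v := by
    intro z hz hz2
    obtain ⟨y, hy⟩ := card_eq_one.1 h2
    have e1 : z ∈ ({y} : Finset V) := by
      rw [← hy]; exact mem_filter.2 ⟨(mem_neighborFinset _ _ _).2 hz, hz2⟩
    have e2 : v ∈ ({y} : Finset V) := by
      rw [← hy]; exact mem_filter.2 ⟨hmem, hv⟩
    rw [mem_singleton] at e1 e2
    rw [e1, e2]
  have hcard : #((G.neighborFinset u).erase v) = 2 := by
    rw [card_erase_of_mem hmem, card_neighborFinset_eq_degree, hu]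
  obtain ⟨w, hw1, -, hw3⟩ := exists_other_of_degree_two hv huv.symm
  by_cases hK : K.Adj u v
  · right
    have h3 := (h.of_three_adj_two hD hu hv hK hw3 hw1).2.2
    have hsub : (G.neighborFinset u).erase v ⊆
        ({x ∈ G.neighborFinset u | Rich G x} : Finset V) := by
      intro x hx
      rw [mem_erase, mem_neighborFinset] at hx
      refine mem_filter.2 ⟨(mem_neighborFinset _ _ _).2 hx.2, ?_⟩
      refine h.rich_of_six_le hD ?_
      rw [h3 x hx.2 hx.1]
      omega
    have h4 := card_le_card hsub
    rw [hcard] at h4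
    rw [numRich] at h7 ⊢
    omega
  · have hK2 : ∀ z, G.degree z = 2 → ¬ K.Adj u z := fun z hz hzu => by
      rw [hone z (h.le hzu) hz] at hzu
      exact hK hzu
    have h3 := h.degree_K_add_numNbr_le hK2
    have hpos : 0 < numRich G u := by
      -- With no rich neighbor, the edge inequality for a `K`-edge `ux` leaves `D ≤ 6`: one from `v`
      -- and at most five from the third neighbor.
      by_contra hc
      have hnr : ∀ x, G.Adj u x → ¬ Rich G x := fun x hx hr => hc (numRich_pos hr hx)
      obtain ⟨x, hx⟩ := (K.degree_pos_iff_exists_adj u).1 (h.pos u (by omega))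
      have hx2 : G.degree x ≠ 2 := fun h' => hK2 x h' hx
      have hxm : x ∈ (G.neighborFinset u).erase v := by
        rw [mem_erase, mem_neighborFinset]
        refine ⟨?_, h.le hx⟩
        rintro rfl
        exact hx2 hv
      obtain ⟨y, hy⟩ : ∃ y, ((G.neighborFinset u).erase v).erase x = {y} := by
        refine card_eq_one.1 ?_
        rw [card_erase_of_mem hxm, hcard]
      have hym : y ∈ ((G.neighborFinset u).erase v).erase x := by rw [hy, mem_singleton]
      rw [mem_erase, mem_erase, mem_neighborFinset] at hym
      have e1 : nbrSum G K u = K.degree v + (K.degree x + K.degree y) := by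
        rw [nbrSum, ← add_sum_erase _ _ hmem, ← add_sum_erase _ _ hxm, hy, sum_singleton]
      have e2 := h.nbrSum_le_of_not_rich hD (hnr x (h.le hx)) (h.le hx).symm hu
      have e3 := h.nbrSum_le_of_not_rich hD (hnr y hym.2.2) hym.2.2.symm hu
      have e4 := h.edge u x hx
      have e5 := (h.of_not_adj hK hw3).2
      omega
    have : numRich G u = 1 ∨ numRich G u = 2 := by omega
    rcases this with h' | h'
    · exact Or.inl ⟨h', hK, by omega⟩
    · exact Or.inr h'

end Core

/-- A vertex of degree at least four with so many neighbors of degree two that it cannot give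
two to each of them. -/
def Poor {V : Type*} [Fintype V] (G : SimpleGraph V) (u : V) : Prop :=
  4 ≤ G.degree u ∧ 2 * numBig G u + 2 * numNbr G 3 u + numNbr G 2 u < 6

/-- The amount that `u`, unless it is rich, gives to each neighbor of degree two. -/
noncomputable def offer {V : Type*} [Fintype V] (G : SimpleGraph V) (u : V) : ℤ :=
  if G.degree u = 2 then 0
  else if (G.degree u = 3 ∧ numNbr G 2 u ≠ 1) ∨ Poor G u then 1 else 2

theorem offer_of_rich {u : V} (hu : Rich G u) : offer G u = 2 := by
  have h1 := hu.1
  have h2 := hu.2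
  have h3 : ¬ Poor G u := fun h => by have := h.2; omega
  rw [offer, if_neg (by omega), if_neg]
  rintro (h | h)
  · omega
  · exact h3 h

theorem offer_cases (u : V) : (offer G u = 0 ∧ G.degree u = 2) ∨
    (offer G u = 1 ∧ ((G.degree u = 3 ∧ numNbr G 2 u ≠ 1) ∨ Poor G u)) ∨
    (offer G u = 2 ∧ G.degree u ≠ 2 ∧ ¬ ((G.degree u = 3 ∧ numNbr G 2 u ≠ 1) ∨ Poor G u)) := by
  unfold offer
  split_ifs with h1 h2
  · exact Or.inl ⟨rfl, h1⟩
  · exact Or.inr (Or.inl ⟨rfl, h2⟩)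
  · exact Or.inr (Or.inr ⟨rfl, h1, h2⟩)

namespace Core

/-- If the other neighbor `u` of `v` offers at most one to `v`, then `w` has a large
neighborhood sum. -/
theorem of_offer_le_one (h : Core D G K) (hD : 7 ≤ D) {u v w : V} (hv : G.degree v = 2)
    (hN : G.neighborFinset v = {u, w}) (hne : w ≠ u) (ho : offer G u ≤ 1) :
    K.degree v = 1 ∧ 3 * D ≤ nbrSum G K w := by
  have huv : G.Adj u v := ((adj_iff_of_neighborFinset hN u).2 (Or.inl rfl)).symm
  have h2 := numNbr_pos huv hv
  -- Such an offer comes from a 2-vertex, a 3-vertex with several 2-neighbors, or a poor vertex. In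
  -- the last case at most one neighbor does not have degree two, and `K` avoids the 2-neighbors.
  have key : ¬ K.Adj u v ∧ K.degree u ≤ 1 := by
    rcases offer_cases (G := G) u with ⟨-, hu⟩ | ⟨-, ⟨hu, hn⟩ | hu⟩ | ⟨h', -⟩
    · have huv' := h.not_adj_two_two hD hu hv
      obtain ⟨y, -, -, hy⟩ := exists_other_of_degree_two hu huv
      exact ⟨huv', (h.of_not_adj (fun h' => huv' h'.symm) hy).2.le⟩
    · have h3 := h.three_of_two_le hD hu (by omega)
      refine ⟨fun huv' => ?_, h3.2.2.le⟩
      exact hn (h.of_three_adj_two hD hu hv huv' hN hne).1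
    · have hr : ¬ Rich G u := fun hr => by have := hu.2; have := hr.2; omega
      have h3 := fun z hz => h.not_adj_of_not_rich hD hu.1 hr (v := z) hz
      have h4 := h.degree_K_add_numNbr_le h3
      have h5 := h.nonleaf_of_big hD hu.1
      have h6 := (h.of_not_rich hD hu.1 hr).1
      have h7 := hu.2
      have h8 := degree_eq_sum G u
      exact ⟨h3 v hv, by omega⟩
    · omega
  obtain ⟨h3, h4⟩ := h.of_not_adj key.1 hN
  have h5 := h.edge_two h3 (by rw [hN, pair_comm]) hne.symm
  exact ⟨h4, by omega⟩

end Core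

end

/-! ### The discharging rule and the balance of rich vertices -/

section

/-- The amount that `x` gives to `v` in the discharging. -/
noncomputable def gives {V : Type*} [Fintype V] (G : SimpleGraph V) (x v : V) : ℤ :=
  if ¬ G.Adj x v then 0
  else if G.degree v = 2 then
    if Rich G x then 4 - (∑ u ∈ G.neighborFinset v, offer G u - offer G x) else offer G x
  else if G.degree v = 3 ∧ Rich G x ∧ 0 < numNbr G 2 v then if numRich G v = 1 then 2 else 1
  else 0

/-- The number of neighbors of `w` of degree `c` to which `w` gives `e`. -/
noncomputable def numGive {V : Type*} [Fintype V] (G : SimpleGraph V) (c : ℕ) (e : ℤ) (w : V) :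
    ℕ :=
  #{v ∈ G.neighborFinset w | G.degree v = c ∧ gives G w v = e}

variable {V : Type*} [Fintype V] {D : ℕ} {G K : SimpleGraph V}

theorem gives_two_of_rich {v u w : V} (hv : G.degree v = 2) (hN : G.neighborFinset v = {u, w})
    (hne : w ≠ u) (hw : Rich G w) : gives G w v = 4 - offer G u := by
  have hwv : G.Adj w v := ((adj_iff_of_neighborFinset hN w).2 (Or.inr rfl)).symm
  rw [gives, if_neg (not_not.2 hwv), if_pos hv, if_pos hw, hN, sum_pair hne.symm]
  ring

theorem gives_two_of_not_rich {v w : V} (hv : G.degree v = 2) (hwv : G.Adj w v)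
    (hw : ¬ Rich G w) : gives G w v = offer G w := by
  rw [gives, if_neg (not_not.2 hwv), if_pos hv, if_neg hw]

theorem gives_three {v w : V} (hv : G.degree v = 3) (hwv : G.Adj w v) (hw : Rich G w) :
    gives G w v = if 0 < numNbr G 2 v then if numRich G v = 1 then 2 else 1 else 0 := by
  rw [gives, if_neg (not_not.2 hwv), if_neg (by omega)]
  simp [hv, hw]

theorem gives_of_degree_ne {v w : V} (h2 : G.degree v ≠ 2) (h3 : G.degree v ≠ 3) :
    gives G w v = 0 := by
  unfold gives
  split_ifs <;> simp_all

theorem gives_three_of_not_rich {v w : V} (hv : G.degree v ≠ 2) (hw : ¬ Rich G w) :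
    gives G w v = 0 := by
  unfold gives
  split_ifs <;> simp_all

theorem gives_of_not_adj {v w : V} (h : ¬ G.Adj w v) : gives G w v = 0 := by
  rw [gives, if_pos h]

theorem numGive_pos {c : ℕ} {e : ℤ} {w v : V} (hwv : G.Adj w v) (hv : G.degree v = c)
    (he : gives G w v = e) : 0 < numGive G c e w :=
  card_pos.2 ⟨v, mem_filter.2 ⟨(mem_neighborFinset _ _ _).2 hwv, hv, he⟩⟩

theorem exists_of_numGive_pos {c : ℕ} {e : ℤ} {w : V} (h : 0 < numGive G c e w) :
    ∃ v, G.Adj w v ∧ G.degree v = c ∧ gives G w v = e := by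
  obtain ⟨v, hv⟩ := card_pos.1 h
  rw [mem_filter, mem_neighborFinset] at hv
  exact ⟨v, hv⟩

/-- The final charge of `w`, in quarters. -/
noncomputable def balance {V : Type*} [Fintype V] (G : SimpleGraph V) (w : V) : ℤ :=
  (if 2 ≤ G.degree w then
    4 * ((numNbr G 2 w + numNbr G 3 w + numBig G w : ℕ) : ℤ) - 12 else 0)
  - ∑ v ∈ G.neighborFinset w, gives G w v + ∑ v ∈ G.neighborFinset w, gives G v w

namespace Core

theorem gives_two_cases (h : Core D G K) (hD : 7 ≤ D) {v w : V} (hw : Rich G w)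
    (hwv : G.Adj w v) (hv : G.degree v = 2) :
    (gives G w v = 4 ∧ K.degree v = 1 ∧ 3 * D ≤ nbrSum G K w) ∨
    (gives G w v = 3 ∧ K.degree v = 1 ∧ 3 * D ≤ nbrSum G K w) ∨ gives G w v = 2 := by
  obtain ⟨u, hu1, hu2, hu3⟩ := exists_other_of_degree_two hv hwv.symm
  rw [pair_comm] at hu3
  rw [gives_two_of_rich hv hu3 hu1.symm hw]
  have key := h.of_offer_le_one hD hv hu3 hu1.symm
  rcases offer_cases (G := G) u with ⟨ho, -⟩ | ⟨ho, -⟩ | ⟨ho, -⟩ <;> rw [ho] at key ⊢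
  · exact Or.inl ⟨rfl, key (by norm_num)⟩
  · exact Or.inr (Or.inl ⟨rfl, key (by norm_num)⟩)
  · exact Or.inr (Or.inr rfl)

theorem gives_three_cases (h : Core D G K) (hD : 7 ≤ D) {v w : V} (hw : Rich G w)
    (hwv : G.Adj w v) (hv : G.degree v = 3) :
    (gives G w v = 2 ∧ K.degree v ≤ 2) ∨ gives G w v = 1 ∨ gives G w v = 0 := by
  rw [gives_three hv hwv hw]
  split_ifs with h1 h2
  · refine Or.inl ⟨rfl, ?_⟩
    rcases Nat.lt_or_ge 1 (numNbr G 2 v) with h3 | h3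
    · have := h.three_of_two_le hD hv h3
      omega
    · obtain ⟨z, hz1, hz2⟩ := exists_of_numNbr_pos h1
      rcases h.three_of_one hD hv (by omega) hz1 hz2 with h4 | h4
      · exact h4.2.2
      · omega
  · exact Or.inr (Or.inl rfl)
  · exact Or.inr (Or.inr rfl)

/-- A gift of 4 means the 2-vertex has a second neighbor of degree two; two such gifts form the
configuration excluded by `Core.link`. -/
theorem numGive_link_le (h : Core D G K) {w : V} (hw : Rich G w) : numGive G 2 4 w ≤ 1 := by
  have key : ∀ v, G.Adj w v → G.degree v = 2 → gives G w v = 4 →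
      ∃ u, u ≠ w ∧ G.Adj v u ∧ G.degree u = 2 := by
    intro v hwv hv hg
    obtain ⟨u, hu1, hu2, hu3⟩ := exists_other_of_degree_two hv hwv.symm
    rw [pair_comm] at hu3
    rw [gives_two_of_rich hv hu3 hu1.symm hw] at hg
    refine ⟨u, hu1, hu2, ?_⟩
    rcases offer_cases (G := G) u with ⟨-, ho⟩ | ⟨ho, -⟩ | ⟨ho, -⟩
    · exact ho
    · omega
    · omega
  refine card_le_one.2 fun v₁ hv₁ v₂ hv₂ => ?_
  by_contra hne
  simp only [mem_filter, mem_neighborFinset] at hv₁ hv₂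
  obtain ⟨u₁, a1, a2, a3⟩ := key v₁ hv₁.1 hv₁.2.1 hv₁.2.2
  obtain ⟨u₂, b1, b2, b3⟩ := key v₂ hv₂.1 hv₂.2.1 hv₂.2.2
  exact h.link w v₁ v₂ u₁ u₂ hv₁.2.1 hv₂.2.1 a3 b3 hv₁.1 hv₂.1 a2 b2 hne a1 b1

theorem numNbr_two_eq (h : Core D G K) (hD : 7 ≤ D) {w : V} (hw : Rich G w) :
    numNbr G 2 w = numGive G 2 4 w + numGive G 2 3 w + numGive G 2 2 w := by
  simp only [numNbr, numGive, card_filter, ← sum_add_distrib]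
  refine sum_congr rfl fun v hv => ?_
  rw [mem_neighborFinset] at hv
  by_cases h2 : G.degree v = 2
  · rcases h.gives_two_cases hD hw hv h2 with h' | h' | h' <;> simp [h2, h']
  · simp [h2]

theorem numNbr_three_eq (h : Core D G K) (hD : 7 ≤ D) {w : V} (hw : Rich G w) :
    numNbr G 3 w = numGive G 3 2 w + numGive G 3 1 w + numGive G 3 0 w := by
  simp only [numNbr, numGive, card_filter, ← sum_add_distrib]
  refine sum_congr rfl fun v hv => ?_
  rw [mem_neighborFinset] at hv
  by_cases h2 : G.degree v = 3
  · rcases h.gives_three_cases hD hw hv h2 with h' | h' | h' <;> simp [h2, h']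
  · simp [h2]

theorem sum_gives_eq (h : Core D G K) (hD : 7 ≤ D) {w : V} (hw : Rich G w) :
    ∑ v ∈ G.neighborFinset w, gives G w v =
      ((4 * numGive G 2 4 w + 3 * numGive G 2 3 w + 2 * numGive G 2 2 w + 2 * numGive G 3 2 w
        + numGive G 3 1 w : ℕ) : ℤ) := by
  simp only [numGive, card_filter, ← sum_add_distrib, mul_sum, Nat.cast_sum]
  refine sum_congr rfl fun v hv => ?_
  rw [mem_neighborFinset] at hv
  by_cases h2 : G.degree v = 2
  · rcases h.gives_two_cases hD hw hv h2 with h' | h' | h' <;> simp [h2, h']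
  by_cases h3 : G.degree v = 3
  · rcases h.gives_three_cases hD hw hv h3 with h' | h' | h' <;> simp [h3, h']
  · simp [h2, h3, gives_of_degree_ne h2 h3]

/-- Expensive neighbors contribute little: 2-vertices receiving 3 or 4 have `K`-degree one, and
3-vertices receiving 2 have `K`-degree at most two. -/
theorem nbrSum_le_of_rich (h : Core D G K) (hD : 7 ≤ D) {w : V} (hw : Rich G w) :
    nbrSum G K w ≤ numNbr G 1 w + numGive G 2 4 w + numGive G 2 3 w + 2 * numGive G 2 2 w
      + 2 * numGive G 3 2 w + 3 * numGive G 3 1 w + 3 * numGive G 3 0 w + D * numBig G w := by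
  simp only [numGive, numNbr, numBig, card_filter, ← sum_add_distrib, mul_sum, nbrSum]
  refine sum_le_sum fun v hv => ?_
  have h1 := one_le_degree_of_mem hv
  rw [mem_neighborFinset] at hv
  have hκ := h.degree_K_le v
  have hκD := h.degree_K_le_D v
  by_cases h2 : G.degree v = 2
  · rw [h2] at hκ
    rcases h.gives_two_cases hD hw hv h2 with h' | h' | h' <;> simp [h2, h'] <;> omega
  by_cases h3 : G.degree v = 3
  · rw [h3] at hκ
    rcases h.gives_three_cases hD hw hv h3 with h' | h' | h' <;> simp [h3, h'] <;> omega
  by_cases h4 : 4 ≤ G.degree v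
  · have h5 : G.degree v ≠ 1 := by omega
    simp [h2, h3, h4, h5, hκD]
  · have h5 : G.degree v = 1 := by omega
    rw [h5] at hκ
    simp [h5, hκ]

theorem nbrSum_of_numGive (h : Core D G K) (hD : 7 ≤ D) {w : V} (hw : Rich G w)
    (hpos : 0 < numGive G 2 4 w + numGive G 2 3 w) : 3 * D ≤ nbrSum G K w := by
  have : 0 < numGive G 2 4 w ∨ 0 < numGive G 2 3 w := by omega
  rcases this with h' | h'
  · obtain ⟨v, hv1, hv2, hv3⟩ := exists_of_numGive_pos h'
    rcases h.gives_two_cases hD hw hv1 hv2 with h4 | h4 | h4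
    · exact h4.2.2
    · exact h4.2.2
    · omega
  · obtain ⟨v, hv1, hv2, hv3⟩ := exists_of_numGive_pos h'
    rcases h.gives_two_cases hD hw hv1 hv2 with h4 | h4 | h4
    · exact h4.2.2
    · exact h4.2.2
    · omega

end Core

/-- A rich vertex of small degree with final charge zero. -/
structure Small {V : Type*} [Fintype V] (G : SimpleGraph V) (w : V) : Prop where
  rich : Rich G w
  n1 : numNbr G 1 w = 0
  big_le : numBig G w ≤ 2
  n2 : numNbr G 2 w = numGive G 2 2 w
  n3 : numNbr G 3 w = numGive G 3 2 w
  sum : numNbr G 2 w + numNbr G 3 w + 2 * numBig G w = 6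

namespace Core

/-- Three big neighbors pay for all gifts, even those of 4. With fewer, a leaf or a gift of 3 or 4
makes the neighborhood sum at least `3D`; as at most one gift is 4, this forces enough cheaper
neighbors for a strict surplus. Otherwise all gifts are at most 2, and the inequality in `Rich`
covers them. -/
theorem balance_of_rich (h : Core D G K) (hD : 7 ≤ D) {w : V} (hw : Rich G w) :
    0 ≤ balance G w ∧ (balance G w = 0 →
      (numBig G w = 3 ∧ numNbr G 3 w = 0 ∧ numNbr G 2 w = numGive G 2 4 w) ∨ Small G w) := by
  have e0 : ∑ v ∈ G.neighborFinset w, gives G v w = 0 :=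
    sum_eq_zero fun v _ => gives_of_degree_ne (by have := hw.1; omega) (by have := hw.1; omega)
  have e1 := h.sum_gives_eq hD hw
  have e2 := h.numNbr_two_eq hD hw
  have e3 := h.numNbr_three_eq hD hw
  have e4 := h.nbrSum_le_of_rich hD hw
  have e5 := h.numGive_link_le hw
  have e6 := h.nbrSum_of_numGive hD hw
  have e7 := h.nonleaf_of_big hD hw.1
  have e8 := hw.2
  have e9 := h.good.degree_le w
  have e10 := degree_eq_sum G w
  have e11 := h.nbrSum_of_numNbr_one (w := w)
  rw [balance, if_pos (by have := hw.1; omega), e0, e1]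
  by_cases hb : 3 ≤ numBig G w
  · refine ⟨by omega, fun h0 => Or.inl (by omega)⟩
  have hb2 : numBig G w ≤ 2 := by omega
  have key : 12 < numNbr G 3 w + 4 * numBig G w + numGive G 2 3 w + 2 * numGive G 2 2 w +
      numGive G 3 2 w + 2 * numGive G 3 1 w + 3 * numGive G 3 0 w ∨
      (numNbr G 1 w = 0 ∧ numNbr G 2 w = numGive G 2 2 w ∧ numNbr G 3 w = numGive G 3 2 w ∧
        numNbr G 2 w + numNbr G 3 w + 2 * numBig G w = 6) := by
    generalize numBig G w = b at *
    interval_cases b <;> omega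
  rcases key with key | key
  · exact ⟨by omega, fun h0 => by omega⟩
  · exact ⟨by omega, fun _ => Or.inr ⟨hw, key.1, hb2, key.2.1, key.2.2.1, key.2.2.2⟩⟩

end Core

end

/-! ### Nonnegative balances and the total charge -/

section

/-- The subgraph of `G` on the vertices satisfying `p`. -/
def onVerts {V : Type*} (G : SimpleGraph V) (p : V → Prop) : SimpleGraph V where
  Adj a b := G.Adj a b ∧ p a ∧ p b
  symm := ⟨fun _ _ h => ⟨h.1.symm, h.2.2, h.2.1⟩⟩
  loopless := ⟨fun _ h => G.loopless.irrefl _ h.1⟩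

theorem onVerts_le {V : Type*} (G : SimpleGraph V) (p : V → Prop) : onVerts G p ≤ G := fun _ _ h => h.1

variable {V : Type*} [Fintype V] {D : ℕ} {G K : SimpleGraph V}

theorem sum_gives_of_not_rich {w : V} (hw : ¬ Rich G w) :
    ∑ v ∈ G.neighborFinset w, gives G w v = numNbr G 2 w * offer G w := by
  rw [numNbr, card_filter, Nat.cast_sum, sum_mul]
  refine sum_congr rfl fun v hv => ?_
  rw [mem_neighborFinset] at hv
  by_cases h2 : G.degree v = 2
  · simp [gives_two_of_not_rich h2 hv hw, h2]
  · simp [gives_three_of_not_rich h2 hw, h2]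

theorem sum_gives_to_three {u : V} (hu : G.degree u = 3) (h2 : 0 < numNbr G 2 u) :
    ∑ v ∈ G.neighborFinset u, gives G v u =
      numRich G u * (if numRich G u = 1 then 2 else 1 : ℤ) := by
  generalize hc : (if numRich G u = 1 then 2 else 1 : ℤ) = c
  rw [numRich, card_filter, Nat.cast_sum, sum_mul]
  refine sum_congr rfl fun v hv => ?_
  rw [mem_neighborFinset] at hv
  by_cases hr : Rich G v
  · simp [gives_three hu hv.symm hr, h2, hr, hc]
  · rw [gives_three_of_not_rich (by omega) hr]
    simp [hr]

namespace Core

theorem balance_of_le_one (h : Core D G K) (hD : 7 ≤ D) {w : V} (hw : G.degree w ≤ 1) :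
    balance G w = 0 := by
  have hr : ¬ Rich G w := fun hr => by have := hr.1; omega
  have e1 : ∑ v ∈ G.neighborFinset w, gives G w v = 0 := by
    refine sum_eq_zero fun v hv => gives_three_of_not_rich (fun h2 => ?_) hr
    rw [mem_neighborFinset] at hv
    have h1 : 0 < G.degree w := (G.degree_pos_iff_exists_adj w).2 ⟨v, hv⟩
    have h3 := numNbr_pos hv.symm (show G.degree w = 1 by omega)
    have h4 := h.no_leaf hD (w := v) (by omega)
    omega
  have e2 : ∑ v ∈ G.neighborFinset w, gives G v w = 0 :=
    sum_eq_zero fun v _ => gives_of_degree_ne (by omega) (by omega)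
  rw [balance, if_neg (by omega), e1, e2]
  rfl

theorem balance_of_two (h : Core D G K) (hD : 7 ≤ D) {v : V} (hv : G.degree v = 2) :
    balance G v = 0 := by
  have hr : ¬ Rich G v := fun hr => by have := hr.1; omega
  have e1 : ∑ x ∈ G.neighborFinset v, gives G v x = 0 := by
    rw [sum_gives_of_not_rich hr, offer, if_pos hv, mul_zero]
  obtain ⟨u, hu⟩ := (G.degree_pos_iff_exists_adj v).1 (by omega)
  obtain ⟨w, hw1, hw2, hN⟩ := exists_other_of_degree_two hv hu
  have hN' : G.neighborFinset v = {w, u} := by rw [hN, pair_comm]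
  have e2 : ∑ x ∈ G.neighborFinset v, gives G x v = 4 := by
    have key : ∀ a b : V, b ≠ a → G.neighborFinset v = {a, b} → G.Adj v a → Rich G b →
        gives G a v + gives G b v = 4 := by
      intro a b hne hab hva hb
      rw [gives_two_of_rich hv hab hne hb]
      by_cases ha : Rich G a
      · rw [gives_two_of_rich hv (by rw [hab, pair_comm]) hne.symm ha, offer_of_rich ha,
          offer_of_rich hb]
        norm_num
      · rw [gives_two_of_not_rich hv hva.symm ha]
        ring
    rw [hN, sum_pair hw1.symm]
    rcases h.rich_or_rich hD hv hN hw1 with h' | h'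
    · rw [add_comm]
      exact key w u hw1.symm hN' hw2 h'
    · exact key u w hw1 hN hu h'
  have e3 := h.no_leaf hD (w := v) (by omega)
  have e4 := degree_eq_sum G v
  rw [balance, if_pos (by omega), e1, e2]
  omega

/-- The initial charge is zero. If there are 2-neighbors, exactly 2 goes out, either to one of them
or as 1 to each of two, and exactly 2 comes in, from one rich neighbor or as 1 from each of two. -/
theorem balance_of_three (h : Core D G K) (hD : 7 ≤ D) {u : V} (hu : G.degree u = 3) :
    balance G u = 0 := by
  have hr : ¬ Rich G u := fun hr => by have := hr.1; omega
  have e3 := h.no_leaf hD (w := u) (by omega)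
  have e4 := degree_eq_sum G u
  have hP : ¬ Poor G u := fun hP => by have := hP.1; omega
  rw [balance, if_pos (by omega), sum_gives_of_not_rich hr]
  rcases Nat.eq_zero_or_pos (numNbr G 2 u) with h0 | h0
  · have e5 : ∑ v ∈ G.neighborFinset u, gives G v u = 0 := by
      refine sum_eq_zero fun v _ => ?_
      unfold gives
      split_ifs <;> first | rfl | omega
    rw [e5, h0]
    push_cast
    omega
  · rw [sum_gives_to_three hu h0]
    rcases Nat.lt_or_ge 1 (numNbr G 2 u) with h2 | h2
    · obtain ⟨h3, h4, -⟩ := h.three_of_two_le hD hu h2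
      have ho : offer G u = 1 := by
        rw [offer, if_neg (by omega), if_pos (Or.inl ⟨hu, by omega⟩)]
      rw [ho, h3, h4]
      norm_num
      omega
    · have h3 : numNbr G 2 u = 1 := by omega
      have ho : offer G u = 2 := by
        rw [offer, if_neg (by omega), if_neg]
        rintro (h' | h')
        · exact h'.2 h3
        · exact hP h'
      obtain ⟨z, hz1, hz2⟩ := exists_of_numNbr_pos h0
      rcases h.three_of_one hD hu h3 hz1 hz2 with h4 | h4
      · rw [ho, h3, h4.1]
        norm_num
        omega
      · rw [ho, h3, h4]
        norm_num
        omega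

/-- Failing `Poor` is exactly what allows paying 2 per 2-neighbor. A poor vertex pays 1 and keeps a
strict surplus, because positivity of its `K`-degree prevents all its neighbors from being
2-vertices. -/
theorem balance_of_not_rich (h : Core D G K) (hD : 7 ≤ D) {w : V} (hw : 4 ≤ G.degree w)
    (hr : ¬ Rich G w) :
    0 ≤ balance G w ∧ (balance G w = 0 → ¬ Poor G w ∧ 0 < numNbr G 2 w) := by
  have e2 : ∑ v ∈ G.neighborFinset w, gives G v w = 0 :=
    sum_eq_zero fun v _ => gives_of_degree_ne (by omega) (by omega)
  have e3 := h.of_not_rich hD hw hr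
  have e4 := degree_eq_sum G w
  have e5 := h.nonleaf_of_big hD hw
  have e6 := h.degree_K_add_numNbr_le (fun z hz => h.not_adj_of_not_rich hD hw hr (v := z) hz)
  have e7 := h.pos w (by omega)
  rw [balance, if_pos (by omega), e2, sum_gives_of_not_rich hr]
  by_cases hP : Poor G w
  · have ho : offer G w = 1 := by rw [offer, if_neg (by omega), if_pos (Or.inr hP)]
    rw [ho]
    exact ⟨by omega, fun _ => by omega⟩
  · have ho : offer G w = 2 := by
      rw [offer, if_neg (by omega), if_neg]
      rintro (h' | h')
      · omega
      · exact hP h'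
    have hP' : 6 ≤ 2 * numBig G w + 2 * numNbr G 3 w + numNbr G 2 w := by
      by_contra hc
      exact hP ⟨hw, by omega⟩
    rw [ho]
    exact ⟨by omega, fun _ => ⟨hP, by omega⟩⟩

theorem balance_nonneg (h : Core D G K) (hD : 7 ≤ D) (w : V) : 0 ≤ balance G w := by
  have hc : G.degree w ≤ 1 ∨ G.degree w = 2 ∨ G.degree w = 3 ∨ 4 ≤ G.degree w := by omega
  rcases hc with hw | hw | hw | hw
  · exact (h.balance_of_le_one hD hw).ge
  · exact (h.balance_of_two hD hw).ge
  · exact (h.balance_of_three hD hw).ge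
  · by_cases hr : Rich G w
    · exact (h.balance_of_rich hD hr).1
    · exact (h.balance_of_not_rich hD hw hr).1

end Core

theorem degree_onVerts (G : SimpleGraph V) (p : V → Prop) (w : V) :
    (onVerts G p).degree w = if p w then #{x ∈ G.neighborFinset w | p x} else 0 := by
  rw [← card_neighborFinset_eq_degree]
  split_ifs with hw
  · congr 1
    ext x
    rw [mem_neighborFinset, mem_filter, mem_neighborFinset]
    simp [onVerts, hw]
  · rw [card_eq_zero, eq_empty_iff_forall_notMem]
    intro x hx
    rw [mem_neighborFinset] at hx
    exact hw hx.2.1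

/-- Apply sparseness to the set of vertices of degree at least two and the handshake lemma to the
subgraph it induces. -/
theorem sum_nonleaf_le (hG : Good D G) :
    ∑ w, (if 2 ≤ G.degree w then
      4 * ((numNbr G 2 w + numNbr G 3 w + numBig G w : ℕ) : ℤ) - 12 else 0) ≤ 0 := by
  have h1 := (onVerts G (fun w => 2 ≤ G.degree w)).sum_degrees_eq_twice_card_edges
  have h2 := hG.sparse {w | 2 ≤ G.degree w}
  have h3 : (onVerts G (fun w => 2 ≤ G.degree w)).edgeFinset =
      {e ∈ G.edgeFinset | ∀ x ∈ e, x ∈ ({w | 2 ≤ G.degree w} : Finset V)} := by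
    ext e
    induction e with
    | h a b =>
      rw [mem_edgeFinset, mem_edgeSet, mem_filter, mem_edgeFinset, mem_edgeSet]
      simp [onVerts]
  rw [← h3, ← h1] at h2
  have h4 : ∀ w, (if 2 ≤ G.degree w then
      4 * ((numNbr G 2 w + numNbr G 3 w + numBig G w : ℕ) : ℤ) - 12 else 0) =
      4 * ((onVerts G (fun w => 2 ≤ G.degree w)).degree w : ℤ) -
        12 * (if 2 ≤ G.degree w then 1 else 0) := by
    intro w
    rw [degree_onVerts]
    split_ifs with hw
    · have h5 : numNbr G 2 w + numNbr G 3 w + numBig G w =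
          #{x ∈ G.neighborFinset w | 2 ≤ G.degree x} := by
        simp only [numNbr, numBig, card_filter, ← sum_add_distrib]
        refine sum_congr rfl fun x _ => ?_
        split_ifs <;> omega
      rw [h5, mul_one]
      congr!
    · simp
  rw [sum_congr rfl fun w _ => h4 w, sum_sub_distrib, ← mul_sum, ← mul_sum, ← Nat.cast_sum,
    sum_boole]
  omega

theorem sum_gives_comm (G : SimpleGraph V) :
    ∑ w, ∑ v ∈ G.neighborFinset w, gives G w v = ∑ w, ∑ v ∈ G.neighborFinset w, gives G v w := by
  have h1 : ∀ w, ∑ v ∈ G.neighborFinset w, gives G w v = ∑ v, gives G w v := fun w =>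
    sum_subset (subset_univ _) fun v _ hv =>
      gives_of_not_adj fun h => hv ((mem_neighborFinset _ _ _).2 h)
  have h2 : ∀ w, ∑ v ∈ G.neighborFinset w, gives G v w = ∑ v, gives G v w := fun w =>
    sum_subset (subset_univ _) fun v _ hv =>
      gives_of_not_adj fun h => hv ((mem_neighborFinset _ _ _).2 h.symm)
  simp only [h1, h2]
  exact sum_comm

theorem Core.balance_eq_zero (h : Core D G K) (hD : 7 ≤ D) (w : V) : balance G w = 0 := by
  have h1 : ∑ w, balance G w ≤ 0 := by
    simp only [balance, sum_add_distrib, sum_sub_distrib]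
    have h2 := sum_nonleaf_le h.good
    have h3 := sum_gives_comm G
    linarith
  have h2 := sum_eq_zero_iff_of_nonneg (fun w (_ : w ∈ univ) => h.balance_nonneg hD w)
  exact h2.1 (le_antisymm h1 (sum_nonneg fun w _ => h.balance_nonneg hD w)) w (mem_univ w)

end

/-! ### Zero balance everywhere forces a 3-regular subgraph -/

section

variable {V : Type*} [Fintype V] {D : ℕ} {G K : SimpleGraph V}

namespace Core

theorem rich_cases (h : Core D G K) (hD : 7 ≤ D) {w : V} (hw : Rich G w) :
    (numBig G w = 3 ∧ numNbr G 3 w = 0 ∧ numNbr G 2 w = numGive G 2 4 w) ∨ Small G w :=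
  (h.balance_of_rich hD hw).2 (h.balance_eq_zero hD w)

theorem numGive_two_three (h : Core D G K) (hD : 7 ≤ D) {w : V} (hw : Rich G w) :
    numGive G 2 3 w = 0 := by
  have h1 := h.numNbr_two_eq hD hw
  rcases h.rich_cases hD hw with h2 | h2
  · omega
  · have := h2.n2
    omega

theorem numGive_three_one (h : Core D G K) (hD : 7 ≤ D) {w : V} (hw : Rich G w) :
    numGive G 3 1 w = 0 := by
  have h1 := h.numNbr_three_eq hD hw
  rcases h.rich_cases hD hw with h2 | h2
  · omega
  · have := h2.n3
    omega

theorem small_of_numGive (h : Core D G K) (hD : 7 ≤ D) {w : V} (hw : Rich G w)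
    (hpos : 0 < numGive G 2 2 w) : Small G w := by
  have h1 := h.numNbr_two_eq hD hw
  rcases h.rich_cases hD hw with h2 | h2
  · omega
  · exact h2

theorem nbrSum_le_of_small (h : Core D G K) (hD : 7 ≤ D) {w : V} (hw : Small G w) :
    nbrSum G K w ≤ 2 * D + 4 := by
  have h1 := h.nbrSum_le_of_rich hD hw.rich
  have h2 := h.numNbr_two_eq hD hw.rich
  have h3 := h.numNbr_three_eq hD hw.rich
  obtain ⟨-, h4, h5, h6, h7, h8⟩ := hw
  generalize numBig G w = b at *
  interval_cases b <;> omega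

/-- No path with ends a rich vertex and a vertex of degree three has a middle vertex of degree
two. -/
theorem not_degree_three (h : Core D G K) (hD : 7 ≤ D) {u v w : V} (hw : Rich G w)
    (hv : G.degree v = 2) (hN : G.neighborFinset v = {u, w}) (hne : w ≠ u) :
    G.degree u ≠ 3 := by
  intro hu
  have huv : G.Adj u v := ((adj_iff_of_neighborFinset hN u).2 (Or.inl rfl)).symm
  have hwv : G.Adj w v := ((adj_iff_of_neighborFinset hN w).2 (Or.inr rfl)).symm
  have h2 := numNbr_pos huv hv
  have hg := gives_two_of_rich hv hN hne hw
  have hP : ¬ Poor G u := fun hP => by have := hP.1; omega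
  rcases Nat.lt_or_ge 1 (numNbr G 2 u) with h3 | h3
  · have ho : offer G u = 1 := by
      rw [offer, if_neg (by omega), if_pos (Or.inl ⟨hu, by omega⟩)]
    rw [ho] at hg
    have h4 := numGive_pos hwv hv hg
    have h5 := h.numGive_two_three hD hw
    norm_num at h4
    omega
  · have h4 : numNbr G 2 u = 1 := by omega
    have ho : offer G u = 2 := by
      rw [offer, if_neg (by omega), if_neg]
      rintro (h' | h')
      · exact h'.2 h4
      · exact hP h'
    rw [ho] at hg
    have h5 := numGive_pos hwv hv hg
    norm_num at h5
    have hS := h.nbrSum_le_of_small hD (h.small_of_numGive hD hw h5)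
    -- If `K` misses `uv`, the edge `wv` of `K` contradicts the small neighborhood sum of `w`.
    -- Otherwise `u` has two rich neighbors, each giving it 1, which zero balance forbids.
    rcases h.three_of_one hD hu h4 huv hv with ⟨-, h6, h7⟩ | h6
    · have h8 := (h.of_not_adj h6 hN)
      have h9 := h.edge_two h8.1 (by rw [hN, pair_comm]) hne.symm
      omega
    · have hm : 0 < numRich G u := by omega
      obtain ⟨x, hx⟩ := card_pos.1 hm
      rw [mem_filter, mem_neighborFinset] at hx
      have h8 := gives_three hu hx.1.symm hx.2
      rw [if_pos h2, if_neg (by omega)] at h8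
      have h9 := numGive_pos hx.1.symm hu h8
      have h10 := h.numGive_three_one hD hx.2
      omega

/-- Such a 3-neighbor receives 2, so it has a 2-neighbor, whose other neighbor must be rich: the
path excluded by `not_degree_three`. -/
theorem small_numNbr_three (h : Core D G K) (hD : 7 ≤ D) {w : V} (hw : Small G w) :
    numNbr G 3 w = 0 := by
  by_contra hc
  rw [hw.n3] at hc
  obtain ⟨u, hwu, hu, hg⟩ := exists_of_numGive_pos (Nat.pos_of_ne_zero hc)
  rw [gives_three hu hwu hw.rich] at hg
  have h2 : 0 < numNbr G 2 u := by
    by_contra h2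
    rw [if_neg h2] at hg
    norm_num at hg
  obtain ⟨v, huv, hv⟩ := exists_of_numNbr_pos h2
  obtain ⟨z, hz1, hz2, hz3⟩ := exists_other_of_degree_two hv huv.symm
  rcases h.rich_or_rich hD hv hz3 hz1 with hr | hr
  · have := hr.1
    omega
  · exact h.not_degree_three hD hr hv hz3 hz1 hu

/-- `K` does not join a small or non-rich vertex to a neighbor of degree two whose other neighbor
is small or not rich. -/
theorem not_adj_of_small (h : Core D G K) (hD : 7 ≤ D) {u v w : V}
    (hw : Small G w) (hu : Small G u ∨ (4 ≤ G.degree u ∧ ¬ Rich G u)) (hv : G.degree v = 2)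
    (hN : G.neighborFinset v = {w, u}) (hne : u ≠ w) : ¬ K.Adj w v := by
  -- With at most one big neighbor at `z` the edge inequality would force `D ≤ 6`. With two, the far
  -- end needs `K`-degree at least `D - 2 ≥ 5`, more than `u` can have.
  have key : ∀ z y x, Small G z → G.degree y = 2 → K.Adj z y → G.neighborFinset y = {z, x} →
      x ≠ z → numBig G z = 2 ∧ D ≤ K.degree x + 2 := by
    intro z y x hz hy hzy hN' hne'
    have h1 := h.edge_two hzy hN' hne'
    have h2 := h.nbrSum_add_cap_le (h.le hzy)
    have h3 : cap D G y = 2 := by simp [cap, hy]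
    have h4 := h.small_numNbr_three hD hz
    have h5 := h.degree_K_le_D x
    have h6 := hz.sum
    have h7 := hz.big_le
    have h8 := hz.n1
    generalize numBig G z = b at *
    interval_cases b <;> omega
  intro hwv
  have h1 := (key w v u hw hv hwv hN hne).2
  have huv : G.Adj u v := ((adj_iff_of_neighborFinset hN u).2 (Or.inr rfl)).symm
  have h2 := numNbr_pos huv hv
  have h3 := degree_eq_sum G u
  have h4 := h.degree_K_le u
  rcases hu with hu | ⟨hu4, hu⟩
  · have h5 := h.small_numNbr_three hD hu
    have h6 := hu.sum
    have h7 := hu.big_le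
    have h8 := hu.n1
    by_cases hb : numBig G u = 2
    · omega
    · have h9 : ∀ z, G.degree z = 2 → ¬ K.Adj u z := by
        intro z hz huz
        obtain ⟨x, hx1, -, hx3⟩ := exists_other_of_degree_two hz (h.le huz).symm
        exact hb (key u z x hu hz huz hx3 hx1).1
      have h10 := h.degree_K_add_numNbr_le h9
      omega
  · have h5 := h.degree_K_add_numNbr_le
      (fun z hz => h.not_adj_of_not_rich hD hu4 hu (v := z) hz)
    have h6 := h.of_not_rich hD hu4 hu
    omega

/-- A small vertex has a 2-neighbor `v` to which it gives 2, and the other neighbor of `v` is then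
small or a non-rich vertex of degree at least four. So `K` avoids both edges at `v`, contradicting
the positive `K`-degree of `v`. -/
theorem not_small (h : Core D G K) (hD : 7 ≤ D) (w : V) : ¬ Small G w := by
  intro hw
  have h1 := h.small_numNbr_three hD hw
  have h2 : 0 < numGive G 2 2 w := by
    have := hw.sum
    have := hw.big_le
    have := hw.n2
    omega
  obtain ⟨v, hwv, hv, hg⟩ := exists_of_numGive_pos h2
  obtain ⟨u, hu1, hu2, hN⟩ := exists_other_of_degree_two hv hwv.symm
  have hN' : G.neighborFinset v = {u, w} := by rw [hN, pair_comm]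
  rw [gives_two_of_rich hv hN' hu1.symm hw.rich] at hg
  have hu3 := h.not_degree_three hD hw.rich hv hN' hu1.symm
  have hu2' : G.degree u ≠ 2 := by
    intro h'
    rw [offer, if_pos h'] at hg
    norm_num at hg
  have hu1' : G.degree u ≠ 1 := fun h' => by
    have h3 := numNbr_pos hu2 h'
    have h4 := h.no_leaf hD (w := v) (by omega)
    omega
  have hu0 : 0 < G.degree u := (G.degree_pos_iff_exists_adj u).2 ⟨v, hu2.symm⟩
  have hu4 : 4 ≤ G.degree u := by omega
  have hu : Small G u ∨ (4 ≤ G.degree u ∧ ¬ Rich G u) := by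
    by_cases hr : Rich G u
    · left
      have h3 := gives_two_of_rich hv hN hu1 hr
      rw [offer_of_rich hw.rich] at h3
      exact h.small_of_numGive hD hr (numGive_pos hu2.symm hv h3)
    · exact Or.inr ⟨hu4, hr⟩
  have h3 := h.not_adj_of_small hD hw hu hv hN hu1
  have h4 := (h.of_not_adj h3 hN).1
  rcases hu with hu | hu
  · exact h.not_adj_of_small hD hu (Or.inl hw) hv hN' hu1.symm h4
  · exact h.not_adj_of_not_rich hD hu.1 hu.2 hv h4

/-- A non-rich vertex with zero balance offers 2 to some 2-vertex, whose other neighbor is rich and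
also gives 2; that neighbor would be small. -/
theorem rich_of_big (h : Core D G K) (hD : 7 ≤ D) {u : V} (hu : 4 ≤ G.degree u) :
    Rich G u := by
  by_contra hr
  obtain ⟨hP, h2⟩ := (h.balance_of_not_rich hD hu hr).2 (h.balance_eq_zero hD u)
  obtain ⟨v, huv, hv⟩ := exists_of_numNbr_pos h2
  obtain ⟨w, hw1, hw2, hN⟩ := exists_other_of_degree_two hv huv.symm
  have hw := (h.rich_or_rich hD hv hN hw1).resolve_left hr
  have hg := gives_two_of_rich hv hN hw1 hw
  have ho : offer G u = 2 := by
    rw [offer, if_neg (by omega), if_neg]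
    rintro (h' | h')
    · omega
    · exact hP h'
  rw [ho] at hg
  exact h.not_small hD w (h.small_of_numGive hD hw (numGive_pos hw2.symm hv hg))

theorem numBig_eq (h : Core D G K) (hD : 7 ≤ D) {u : V} (hu : 4 ≤ G.degree u) :
    numBig G u = 3 := by
  rcases h.rich_cases hD (h.rich_of_big hD hu) with h1 | h1
  · exact h1.1
  · exact (h.not_small hD u h1).elim

theorem degree_le_three (h : Core D G K) (hD : 7 ≤ D) (u : V) : G.degree u ≤ 3 := by
  by_contra hu
  have h1 := h.numBig_eq hD (u := u) (by omega)
  have h2 := h.good.noReg (onVerts G fun w => 4 ≤ G.degree w) (onVerts_le _ _) (fun v => by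
    rw [degree_onVerts]
    split_ifs with hv
    · refine Or.inr (Eq.trans ?_ (h.numBig_eq hD hv))
      rw [numBig]
      congr!
    · exact Or.inl rfl)
  obtain ⟨x, hx⟩ := card_pos.1 (show 0 < numBig G u by omega)
  rw [mem_filter, mem_neighborFinset] at hx
  have h3 : (onVerts G fun w => 4 ≤ G.degree w).Adj u x := ⟨hx.1, by omega, hx.2⟩
  rw [h2] at h3
  exact h3

theorem false (h : Core D G K) (hD : 7 ≤ D) : False := by
  have h3 := h.degree_le_three hD
  have hnr : ∀ u, ¬ Rich G u := fun u hu => by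
    have := h3 u
    have := hu.1
    omega
  have h2 : ∀ u, G.degree u ≠ 2 := by
    intro v hv
    obtain ⟨u, hu⟩ := (G.degree_pos_iff_exists_adj v).1 (by omega)
    obtain ⟨w, hw1, hw2, hN⟩ := exists_other_of_degree_two hv hu
    rcases h.rich_or_rich hD hv hN hw1 with h' | h'
    · exact hnr _ h'
    · exact hnr _ h'
  have h1 : ∀ u, G.degree u ≠ 1 := by
    intro v hv
    obtain ⟨u, hu⟩ := (G.degree_pos_iff_exists_adj v).1 (by omega)
    have h4 := numNbr_pos hu.symm hv
    have h5 := h.no_leaf hD (h3 u)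
    omega
  have h4 := h.good.noReg G le_rfl (fun v => by
    have := h1 v
    have := h2 v
    have := h3 v
    omega)
  exact h.ne_bot (le_bot_iff.1 (h4 ▸ h.le))

end Core

end

/-! ### Induction on the number of edges and translation of the hypotheses -/

theorem Good.colorableOn {V : Type*} [Fintype V] {D : ℕ} (hD : 7 ≤ D) {G : SimpleGraph V}
    (hG : Good D G) : ColorableOn G G.edgeSet (3 * D) := by
  induction hn : G.edgeSet.ncard using Nat.strong_induction_on generalizing G with
  | _ n ih =>
    by_contra hc
    obtain ⟨K, hK⟩ := exists_core_graph hG (by omega)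
      (fun G' hG' hlt => ih _ (hn ▸ hlt) hG' rfl) hc
    exact hK.false hD

theorem good_of_maxAverageDegree_le {V : Type*} [Fintype V] {D : ℕ} {G : SimpleGraph V}
    (hdeg : ∀ v, G.degree v ≤ D) (hmad : G.maxAverageDegree ≤ 3)
    (hreg : ¬ G.HasRegularSubgraph 3) : Good D G where
  degree_le := hdeg
  sparse S := by
    rcases S.eq_empty_or_nonempty with rfl | hS
    · simp only [card_empty, mul_zero, nonpos_iff_eq_zero, mul_eq_zero, OfNat.ofNat_ne_zero,
        false_or, card_eq_zero, filter_eq_empty_iff]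
      intro e _ he
      induction e with
      | h a b => exact absurd (he a (Sym2.mem_mk_left _ _)) (notMem_empty _)
    · have hne : ((⊤ : G.Subgraph).induce (S : Set V)).verts.Nonempty := hS
      have h1 : ((⊤ : G.Subgraph).induce (S : Set V)).averageDegree ≤ 3 := by
        refine le_trans ?_ hmad
        exact le_ciSup (f := fun H : {H : G.Subgraph // H.verts.Nonempty} => H.1.averageDegree)
          (Set.finite_range _).bddAbove ⟨_, hne⟩
      have hE : ((⊤ : G.Subgraph).induce (S : Set V)).edgeSet =
          ({e ∈ G.edgeFinset | ∀ x ∈ e, x ∈ S} : Finset _) := by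
        ext e
        induction e with
        | h a b =>
          simp only [Subgraph.mem_edgeSet, Subgraph.induce_adj, Subgraph.top_adj, coe_filter,
            mem_edgeFinset, mem_edgeSet, Sym2.mem_iff, Set.mem_ofPred_eq, mem_coe,
            forall_eq_or_imp, forall_eq]
          tauto
      rw [Subgraph.averageDegree, hE, Set.ncard_coe_finset, Subgraph.induce_verts,
        Set.ncard_coe_finset, div_le_iff₀ (by exact_mod_cast hS.card_pos)] at h1
      exact_mod_cast h1
  noReg H hH hdegH := by
    by_contra hne
    -- Restricting to the support discards the isolated vertices that `noReg` tolerates but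
    -- regularity does not.
    refine hreg ⟨⟨H.support, H.Adj, fun h => hH h, fun h => H.mem_support.2 ⟨_, h⟩, H.symm⟩,
      ?_, ?_⟩
    · obtain ⟨a, b, hab⟩ := H.ne_bot_iff_exists_adj.1 hne
      exact ⟨a, H.mem_support.2 ⟨b, hab⟩⟩
    · intro v hv
      have h1 : H.degree v = 3 :=
        (hdegH v).resolve_left ((H.degree_pos_iff_exists_adj v).2 (H.mem_support.1 hv)).ne'
      have h2 : Subgraph.neighborSet ⟨H.support, H.Adj, fun h => hH h,
          fun h => H.mem_support.2 ⟨_, h⟩, H.symm⟩ v = (H.neighborFinset v : Set V) := by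
        ext z
        simp
      rw [h2, Set.encard_coe_eq_coe_finsetCard, card_neighborFinset_eq_degree, h1]

end StrongEdge
end SimpleGraph

theorem mainTheorem5 {V : Type*} [Fintype V] (G : SimpleGraph V) [DecidableRel G.Adj]
    (Δ : ℕ) (hΔ : 7 ≤ Δ)
    (hreg : ¬ G.HasRegularSubgraph 3)
    (hdeg : G.maxDegree ≤ Δ)
    (hmad : G.maxAverageDegree ≤ 3) :
    G.strongChromaticIndex ≤ ((3 * Δ : ℕ) : ℕ∞) := by
  have hG : SimpleGraph.StrongEdge.Good Δ G := by
    refine SimpleGraph.StrongEdge.good_of_maxAverageDegree_le (fun v => ?_) hmad hreg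
    refine le_trans (le_of_eq ?_) ((G.degree_le_maxDegree v).trans hdeg)
    congr!
  exact iInf₂_le_of_le (3 * Δ)
    (SimpleGraph.StrongEdge.strongEdgeColorable_of_colorableOn (hG.colorableOn hΔ)) le_rfl
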